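/- Let $n\ge 3$. For $t=(t_1,\dots,t_n)\in\mathbb C^n$ put $$P(x)=x^{n-1}+t_{n-1}x^{n-2}+\dots+t_2x+t_1,\qquad f_t(x,y)=P(x)+xy^2+t_ny,$$ the miniversal deformation of $f=x^{n-1}+xy^2$. (In the usual numbering $f$ is the singularity $D_n$; the case of $D_{n+1}$ is obtained by replacing $n$ by $n+1$.) Saito's Frobenius structure with primitive form $dx\wedge dy$ is the following data on each tangent space $T_t\mathbb C^n$: by the Kodaira–Spencer map $\partial\mapsto[\partial f_t]\in\mathbb C[x,y]/(\partial_xf_t,\partial_yf_t)$ the product $\circ$ is that of the Jacobi ring, the unit field $e$ corresponds to $[1]$ and the Euler field $E$ to $[f_t]$; the pairing is the Grothendieck residue pairing $$\langle\partial_1,\partial_2\rangle=\operatorname{Res}\frac{\partial_1f_t\,\partial_2f_t\;dx\wedge dy}{\partial_xf_t\;\partial_yf_t} =\lim_{w\to0}\ \sum_{\nabla f_t(p)=w}\frac{\partial_1f_t(p)\,\partial_2f_t(p)}{H(p)},$$ where $H$ is the Hessian determinant of $f_t$ and $w\in\mathbb C^2$ runs through regular values of $\nabla f_t$; if all critical points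 of $f_t$ are nondegenerate it is the sum of $\partial_1f_t\,\partial_2f_t/H$ over the critical points. Then for every $t\in\mathbb C^n$ these data exist and are unique, and they depend continuously on $t$. On the dense open set $\{t_n\neq0\}$ they are given by the one-variable superpotential $$\lambda(z)=P(z^2)-\frac{t_n^2}{4z^2}$$ as follows: for every $t$ with $t_n\ne0$ the unique bilinear pairing, bilinear product $\circ$, unit $e$ of $\circ$ and vector $E$ on $T_t\mathbb C^n$ with $$\langle\partial_1,\partial_2\rangle=-(\operatorname{Res}_{z=\infty}+\operatorname{Res}_{z=0})\frac{\partial_1\lambda\,\partial_2\lambda}{\lambda'}dz,\qquad \langle\partial_1\circ\partial_2,\partial_3\rangle=-(\operatorname{Res}_{z=\infty}+\operatorname{Res}_{z=0})\frac{\partial_1\lambda\,\partial_2\lambda\,\partial_3\lambda}{\lambda'}dz,$$ $$\langle E,\partial_1\rangle=-(\operatorname{Res}_{z=\infty}+\operatorname{Res}_{z=0})\frac{\lambda\,\partial_1\lambda}{\lambda'}dz$$ are those of Saito's structure at $t$. If the constant $-1$ is replaced by $-2$ in the three formulas, so that $$\langle\partial_1,\partial_2\rangle=-2(\operatorname{Res}_{z=\infty}+\operatorname{Res}_{z=0})\frac{\partial_1\lambda\,\partial_2\lambda}{\lambda'}dz,$$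 the result is Saito's structure with the pairing multiplied by $2$ (primitive form $\sqrt2\,dx\wedge dy$) and with the same product, unit and Euler field. -/

import Mathlib

open scoped BigOperators Topology Real
open Filter

noncomputable section

namespace DSing

/-- The space of deformation parameters `(t_1, …, t_n)`, `n = m + 1`. The parameter `t_i` is
the coordinate with index `i - 1`; the last one, `t_n`, is `t (Fin.last m)`. -/
abbrev Params (m : ℕ) : Type := Fin (m + 1) → ℂ

/-- `P(x) = x^m + t_m x^(m-1) + … + t_1`, with `m = n - 1`. -/
def P {m : ℕ} (t : Params m) : Polynomial ℂ :=
  Polynomial.X ^ m +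
    ∑ i : Fin m, Polynomial.C (t i.castSucc) * Polynomial.X ^ (i : ℕ)

/-- The miniversal deformation `f_t(x, y) = P(x) + x y² + t_n y` of `x^m + x y²`;
the variable `x` is `X 0`, the variable `y` is `X 1`. -/
def f {m : ℕ} (t : Params m) : MvPolynomial (Fin 2) ℂ :=
  Polynomial.aeval (MvPolynomial.X 0) (P t) +
    MvPolynomial.X 0 * MvPolynomial.X 1 ^ 2 +
    MvPolynomial.C (t (Fin.last m)) * MvPolynomial.X 1

/-- `∂_u f_t`, the derivative of the deformation in the direction of the tangent vector `u`
(see `hasDerivAt_f`). It does not depend on `t`, since `f_t` is affine in `t`. -/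
def df {m : ℕ} (u : Params m) : MvPolynomial (Fin 2) ℂ :=
  (∑ i : Fin m, MvPolynomial.C (u i.castSucc) * MvPolynomial.X 0 ^ (i : ℕ)) +
    MvPolynomial.C (u (Fin.last m)) * MvPolynomial.X 1

theorem f_add_smul {m : ℕ} (t u : Params m) (s : ℂ) :
    f (t + s • u) = f t + MvPolynomial.C s * df u := by
  simp only [f, df, P, map_add, map_sum, map_mul, map_pow, Polynomial.aeval_X,
    Polynomial.aeval_C, Pi.add_apply, Pi.smul_apply, smul_eq_mul, MvPolynomial.algebraMap_eq,
    add_mul, mul_add, Finset.sum_add_distrib, Finset.mul_sum, mul_assoc]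
  ring

theorem hasDerivAt_f {m : ℕ} (t u : Params m) (p : Fin 2 → ℂ) :
    HasDerivAt (fun s : ℂ => MvPolynomial.eval p (f (t + s • u)))
      (MvPolynomial.eval p (df u)) 0 := by
  simp only [f_add_smul, map_add, map_mul, MvPolynomial.eval_C]
  simpa using ((hasDerivAt_id (0 : ℂ)).mul_const (MvPolynomial.eval p (df u))).const_add
    (MvPolynomial.eval p (f t))

/-- The ideal `(∂F/∂x, ∂F/∂y)`; the Jacobi ring of `F` is the quotient by it. -/
def jacobianIdeal (F : MvPolynomial (Fin 2) ℂ) : Ideal (MvPolynomial (Fin 2) ℂ) :=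
  Ideal.span {MvPolynomial.pderiv 0 F, MvPolynomial.pderiv 1 F}

/-- The gradient map `(∂F/∂x, ∂F/∂y) : ℂ² → ℂ²`. -/
def gradient (F : MvPolynomial (Fin 2) ℂ) (p : Fin 2 → ℂ) : Fin 2 → ℂ :=
  fun i => MvPolynomial.eval p (MvPolynomial.pderiv i F)

/-- The Hessian determinant of `F` at a point. -/
def hessian (F : MvPolynomial (Fin 2) ℂ) (p : Fin 2 → ℂ) : ℂ :=
  Matrix.det (Matrix.of fun i j : Fin 2 =>
    MvPolynomial.eval p (MvPolynomial.pderiv i (MvPolynomial.pderiv j F)))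

/-- The regular values of the gradient map. -/
def regularValues (F : MvPolynomial (Fin 2) ℂ) : Set (Fin 2 → ℂ) :=
  {w | ∀ p, gradient F p = w → hessian F p ≠ 0}

/-- `r` is the (global) Grothendieck residue of `g dx ∧ dy / (∂F/∂x · ∂F/∂y)`: the limit of
`∑ g(p) / H(p)`, over the points `p` with `(∂F/∂x, ∂F/∂y)(p) = w`, as the regular value `w` of
the gradient map tends to `0`. If all critical points of `F` are nondegenerate, then `0` is
itself a regular value and `r` is `∑ g(p) / H(p)` over the critical points `p` of `F`
(see `IsGlobalResidue.eq_sum_of_nondegenerate`). -/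
def IsGlobalResidue (F g : MvPolynomial (Fin 2) ℂ) (r : ℂ) : Prop :=
  Tendsto
    (fun w : Fin 2 → ℂ =>
      ∑ᶠ (p : Fin 2 → ℂ) (_ : gradient F p = w), MvPolynomial.eval p g / hessian F p)
    (𝓝[regularValues F] 0) (𝓝 r)

theorem IsGlobalResidue.eq_sum_of_nondegenerate {F g : MvPolynomial (Fin 2) ℂ} {r : ℂ}
    (h : IsGlobalResidue F g r) (h0 : ∀ p, gradient F p = 0 → hessian F p ≠ 0) :
    r = ∑ᶠ (p : Fin 2 → ℂ) (_ : gradient F p = 0), MvPolynomial.eval p g / hessian F p :=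
  (tendsto_nhds_unique
    (tendsto_pure_nhds (fun w : Fin 2 → ℂ =>
      ∑ᶠ (p : Fin 2 → ℂ) (_ : gradient F p = w), MvPolynomial.eval p g / hessian F p) 0)
    (h.mono_left (pure_le_nhdsWithin h0))).symm

/-- The data of a Frobenius structure on a tangent space `V`: the pairing (metric), the
multiplication, its unit, and the value of the Euler vector field. -/
@[ext]
structure FrobeniusData (V : Type) [AddCommGroup V] [Module ℂ V] where
  pairing : V →ₗ[ℂ] V →ₗ[ℂ] ℂ
  mul : V →ₗ[ℂ] V →ₗ[ℂ] V
  unit : V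
  euler : V

/-- The same multiplication, unit and Euler field, with the pairing multiplied by `c`. -/
def FrobeniusData.rescale {V : Type} [AddCommGroup V] [Module ℂ V]
    (c : ℂ) (D : FrobeniusData V) : FrobeniusData V :=
  { D with pairing := c • D.pairing }

/-- Saito's structure on the tangent space at `t`, with primitive form `dx ∧ dy`: the
Kodaira-Spencer map `u ↦ [∂_u f_t]` to the Jacobi ring of `f_t` carries the multiplication to
that of the ring, the unit to `[1]`, the Euler field to `[f_t]`, and the pairing is the
Grothendieck residue pairing of the Jacobi ring. -/
structure IsSaito {m : ℕ} (t : Params m) (D : FrobeniusData (Params m)) : Prop where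
  pairing : ∀ u v, IsGlobalResidue (f t) (df u * df v) (D.pairing u v)
  mul : ∀ u v, df u * df v - df (D.mul u v) ∈ jacobianIdeal (f t)
  unit : 1 - df D.unit ∈ jacobianIdeal (f t)
  euler : f t - df D.euler ∈ jacobianIdeal (f t)

/-- The superpotential `λ(z) = P(z²) - t_n² / (4 z²)`. -/
def lam {m : ℕ} (t : Params m) (z : ℂ) : ℂ :=
  (P t).eval (z ^ 2) - t (Fin.last m) ^ 2 / (4 * z ^ 2)

/-- `∂_u λ(z)` at `t`: the derivative in the direction of the tangent vector `u` in the
parameters, for fixed `z`. -/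
def dlam {m : ℕ} (t u : Params m) (z : ℂ) : ℂ :=
  deriv (fun s : ℂ => lam (t + s • u) z) 0

/-- `Res_{z=0} g(z) dz`, for `g` holomorphic in a punctured neighbourhood of `0`. -/
def resZero (g : ℂ → ℂ) : ℂ :=
  limUnder (𝓝[>] (0 : ℝ)) fun r : ℝ =>
    (2 * π * Complex.I)⁻¹ * ∮ z in C(0, r), g z

/-- `Res_{z=∞} g(z) dz`, for `g` holomorphic in a punctured neighbourhood of `∞`. -/
def resInfty (g : ℂ → ℂ) : ℂ :=
  limUnder (atTop : Filter ℝ) fun R : ℝ =>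
    -((2 * π * Complex.I)⁻¹ * ∮ z in C(0, R), g z)

/-- `(Res_{z=∞} + Res_{z=0}) (g(z) / λ'(z)) dz`. -/
def resLam {m : ℕ} (t : Params m) (g : ℂ → ℂ) : ℂ :=
  resInfty (fun z => g z / deriv (lam t) z) + resZero (fun z => g z / deriv (lam t) z)

/-- The structure on the tangent space at `t` given by the superpotential `λ` and the constant
`c` in front of the residues: the pairing is `c (Res_∞ + Res_0) (∂_u λ ∂_v λ / λ') dz`, the
multiplication is given by `⟨u ∘ v, s⟩ = c (Res_∞ + Res_0) (∂_u λ ∂_v λ ∂_s λ / λ') dz`, the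
unit is the unit of the multiplication, and the Euler field is the vector represented by `λ`. -/
structure IsLG {m : ℕ} (c : ℂ) (t : Params m) (D : FrobeniusData (Params m)) : Prop where
  pairing : ∀ u v, D.pairing u v = c * resLam t (fun z => dlam t u z * dlam t v z)
  mul : ∀ u v s, D.pairing (D.mul u v) s =
    c * resLam t (fun z => dlam t u z * dlam t v z * dlam t s z)
  unit : ∀ v, D.mul D.unit v = v
  euler : ∀ s, D.pairing D.euler s = c * resLam t (fun z => lam t z * dlam t s z)

end DSing

end

noncomputable section

namespace DSing

/-! Write s = t_n. The relations are ∂_x f = P'(x) + y² and ∂_y f = 2xy + s. They reduce every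
polynomial to a combination of 1, x, …, x^(m-1), y with coefficients continuous in t
(`HasContReduction.const`). A degree count in ℂ[x, y]/(y² + P') shows that these monomials are
independent (`eq_zero_of_df_mem`). So the Kodaira–Spencer map is bijective for every t, and product,
unit and Euler vector are determined and continuous.

The residue is the functional "coefficient of x^(m-1), divided by 2m" on normal forms. If all
critical points are nondegenerate, this is Lagrange interpolation at their abscissae
(`sum_eval_div_derivative`), done separately for s ≠ 0 and s = 0. For the limit in the definition,
note that the fibre of ∇f_t over w is the critical set of f_t - w_0 x - w_1 y. For m ≥ 2 this is
again a member of the family, with the same Hessian. So the sum over a regular fibre is a continuous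
function of w, evaluated at a shifted parameter, and its limit is the value at w = 0
(`isGlobalResidue_f`). The limit is unique because regular values accumulate at 0.

For s ≠ 0, λ is the restriction of f_t to the curve ∂_y f = 0, with x = z². If G = ∂_u f + a ∂_x f +
b ∂_y f, then on that curve G/λ' is z N(z²)/Q(z²) + a/(2z), where Q = 4x²P' + s² and N = 2x · upoly
u - s u_n. The last term is holomorphic off 0, so its residues at 0 and ∞ cancel. The first term is
regular at 0 and its leading behaviour at ∞ gives minus the residue of u (`resLam_eq`).
Nondegeneracy of the pairing (`eq_zero_of_saito_pairing`) then recovers product, unit and Euler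
vector from the residue formulas. -/

variable {m : ℕ}

/-! ### Tangent vectors, the Jacobian ideal and the derivative of P -/

/-- The polynomial `∑ u_i x^(i-1)`, the part of a tangent vector `u` that does not involve `y`. -/
def upoly (u : Params m) : Polynomial ℂ :=
  ∑ i : Fin m, Polynomial.C (u i.castSucc) * Polynomial.X ^ (i : ℕ)

theorem P_eq (t : Params m) : P t = Polynomial.X ^ m + upoly t := rfl

theorem df_eq (u : Params m) :
    df u = Polynomial.aeval (MvPolynomial.X 0) (upoly u) +
      MvPolynomial.C (u (Fin.last m)) * MvPolynomial.X 1 := by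
  simp [df, upoly, MvPolynomial.algebraMap_eq]

theorem upoly_coeff (u : Params m) (i : Fin m) : (upoly u).coeff i = u i.castSucc := by
  simp [upoly, Polynomial.coeff_X_pow, Fin.val_inj]

theorem upoly_degree_lt (u : Params m) : (upoly u).degree < m := by
  unfold upoly
  refine (Polynomial.degree_sum_le _ _).trans_lt ?_
  rw [Finset.sup_lt_iff (by exact WithBot.bot_lt_coe m)]
  intro i _
  exact (Polynomial.degree_C_mul_X_pow_le _ _).trans_lt (by exact_mod_cast i.2)

theorem upoly_natDegree_le (u : Params m) : (upoly u).natDegree ≤ m - 1 := by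
  rcases eq_or_ne (upoly u) 0 with h | h
  · simp [h]
  · have := (Polynomial.natDegree_lt_iff_degree_lt h).2 (upoly_degree_lt u)
    omega

theorem ext_of_upoly {u v : Params m} (h : upoly u = upoly v)
    (hl : u (Fin.last m) = v (Fin.last m)) : u = v := by
  funext i
  refine Fin.lastCases hl (fun i => ?_) i
  rw [← upoly_coeff u, h, upoly_coeff]

/-- `u ↦ ∂_u f_t` as a linear map. -/
def dfLin (m : ℕ) : Params m →ₗ[ℂ] MvPolynomial (Fin 2) ℂ where
  toFun := df
  map_add' u v := by
    simp only [df, Pi.add_apply, map_add, add_mul, Finset.sum_add_distrib]; ring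
  map_smul' c u := by
    simp only [df, Pi.smul_apply, smul_eq_mul, map_mul, mul_assoc, ← Finset.mul_sum, RingHom.id_apply,
      MvPolynomial.smul_eq_C_mul, mul_add]

@[simp] theorem dfLin_apply (u : Params m) : dfLin m u = df u := rfl

theorem pderiv_zero_f (t : Params m) : MvPolynomial.pderiv 0 (f t) =
    Polynomial.aeval (MvPolynomial.X 0) (P t).derivative + MvPolynomial.X 1 ^ 2 := by
  simp [f, Derivation.map_aeval, MvPolynomial.pderiv_X, Derivation.leibniz]

theorem pderiv_one_f (t : Params m) : MvPolynomial.pderiv 1 (f t) =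
    2 * MvPolynomial.X 0 * MvPolynomial.X 1 + MvPolynomial.C (t (Fin.last m)) := by
  simp [f, Derivation.map_aeval, MvPolynomial.pderiv_X, Derivation.leibniz]
  ring

theorem mem_jacobianIdeal_f {t : Params m} {g : MvPolynomial (Fin 2) ℂ} :
    g ∈ jacobianIdeal (f t) ↔ ∃ a b : MvPolynomial (Fin 2) ℂ,
      a * (Polynomial.aeval (MvPolynomial.X 0) (P t).derivative + MvPolynomial.X 1 ^ 2) +
      b * (2 * MvPolynomial.X 0 * MvPolynomial.X 1 + MvPolynomial.C (t (Fin.last m))) = g := by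
  rw [jacobianIdeal, Ideal.mem_span_pair, pderiv_zero_f, pderiv_one_f]

/-- The truncated exponent at i = 0 is harmless, since its coefficient carries the factor i. -/
theorem derivative_P (t : Params m) : (P t).derivative = Polynomial.C (m : ℂ) * Polynomial.X ^ (m - 1) +
    ∑ i : Fin m, Polynomial.C (t i.castSucc * i) * Polynomial.X ^ ((i : ℕ) - 1) := by
  simp [P_eq, upoly, Polynomial.derivative_X_pow, mul_assoc]

theorem degree_derivative_upoly_lt (hm : 1 ≤ m) (u : Params m) :
    (upoly u).derivative.degree < (m - 1 : ℕ) := by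
  rcases eq_or_ne (upoly u) 0 with h | h
  · rw [h, Polynomial.derivative_zero, Polynomial.degree_zero]; exact WithBot.bot_lt_coe _
  · rw [Polynomial.degree_lt_iff_coeff_zero]
    intro k hk
    rw [Polynomial.coeff_derivative, Polynomial.coeff_eq_zero_of_degree_lt, zero_mul]
    exact (upoly_degree_lt u).trans_le (by exact_mod_cast (by omega))

theorem coeff_derivative_P (hm : 1 ≤ m) (t : Params m) :
    (P t).derivative.coeff (m - 1) = m := by
  rw [P_eq, Polynomial.derivative_add, Polynomial.coeff_add,
    Polynomial.coeff_eq_zero_of_degree_lt (degree_derivative_upoly_lt hm t),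
    Polynomial.derivative_X_pow]
  simp

theorem natDegree_derivative_P (hm : 1 ≤ m) (t : Params m) :
    (P t).derivative.natDegree = m - 1 := by
  refine le_antisymm ?_ (Polynomial.le_natDegree_of_ne_zero ?_)
  · rw [P_eq, Polynomial.derivative_add]
    refine (Polynomial.natDegree_add_le _ _).trans (max_le ?_ ?_)
    · refine (Polynomial.natDegree_derivative_le _).trans ?_
      simp
    · exact Polynomial.natDegree_le_of_degree_le (degree_derivative_upoly_lt hm t).le
  · rw [coeff_derivative_P hm]; exact_mod_cast (by omega)

theorem derivative_P_ne_zero (hm : 1 ≤ m) (t : Params m) : (P t).derivative ≠ 0 := by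
  intro h
  have := coeff_derivative_P hm t
  rw [h, Polynomial.coeff_zero] at this
  exact absurd this.symm (by exact_mod_cast (by omega))

/-! ### Linear independence of the monomials in the Jacobi ring -/

-- These are the two coordinates of (a + b y)(2xy + s) = c + e y when y² = -R. If b ≠ 0, the first
-- equation forces deg a > deg b and the second deg a < deg b. With b = 0, the second equation
-- leaves 2x a constant, so a = 0.
open Polynomial in
theorem eq_zero_of_mul_system {R a b c : ℂ[X]} {s e : ℂ} (hR : R ≠ 0)
    (hc : c.natDegree ≤ R.natDegree) (h1 : c = C s * a - 2 * X * b * R)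
    (h2 : C e = 2 * X * a + C s * b) : c = 0 ∧ e = 0 := by
  have key : ∀ q : ℂ[X], q ≠ 0 → (2 * X * q).natDegree = q.natDegree + 1 := by
    intro q hq
    have : (2 * X * q : ℂ[X]) = C 2 * (q * X) := by rw [map_ofNat]; ring
    rw [this, natDegree_C_mul (by norm_num), natDegree_mul_X hq]
  have hb : b = 0 := by
    by_contra hb
    have hbR : b * R ≠ 0 := mul_ne_zero hb hR
    have e1 : 2 * X * (b * R) = C s * a - c := by rw [h1]; ring
    have d1 : b.natDegree + R.natDegree + 1 ≤ max a.natDegree c.natDegree := by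
      rw [← natDegree_mul hb hR, ← key _ hbR, e1]
      exact (natDegree_sub_le _ _).trans (max_le_max (natDegree_C_mul_le _ _) le_rfl)
    have d2 : b.natDegree + R.natDegree + 1 ≤ a.natDegree := by
      rcases le_max_iff.1 d1 with h | h <;> omega
    have ha : a ≠ 0 := by rintro rfl; simp at d2
    have e2 : 2 * X * a = C e - C s * b := by rw [h2]; ring
    have d3 : a.natDegree + 1 ≤ b.natDegree := by
      rw [← key _ ha, e2]
      refine (natDegree_sub_le _ _).trans (max_le (by simp) (natDegree_C_mul_le _ _))
    omega
  subst hb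
  have ha : a = 0 := by
    by_contra ha
    have := key a ha
    have h3 : 2 * X * a = C e := by rw [h2]; ring
    rw [h3, natDegree_C] at this
    omega
  subst ha
  refine ⟨by rw [h1]; ring, ?_⟩
  have : C e = (0 : ℂ[X]) := by rw [h2]; ring
  simpa using this

/-- `ℂ[x, y] / (y² + R)` as a free `ℂ[x]`-module of rank two. -/
abbrev QuadraticBase (R : Polynomial ℂ) : Type := QuadraticAlgebra (Polynomial ℂ) (-R) 0

/-- The monomials `1, x, …, x^(m-1), y` are linearly independent in the Jacobi ring. -/
theorem eq_zero_of_df_mem (hm : 1 ≤ m) {t u : Params m} (h : df u ∈ jacobianIdeal (f t)) :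
    u = 0 := by
  obtain ⟨a, b, hab⟩ := mem_jacobianIdeal_f.1 h
  -- Modulo ∂_x f = P' + y² only the multiple b of ∂_y f survives, and it can be compared
  -- coordinatewise in the basis 1, y over ℂ[x].
  let φ : MvPolynomial (Fin 2) ℂ →ₐ[ℂ] QuadraticBase (P t).derivative :=
    MvPolynomial.aeval ![algebraMap (Polynomial ℂ) (QuadraticBase (P t).derivative) Polynomial.X, (⟨0, 1⟩ : QuadraticBase (P t).derivative)]
  have hx : ∀ q : Polynomial ℂ, φ (Polynomial.aeval (MvPolynomial.X 0) q) =
      algebraMap (Polynomial ℂ) (QuadraticBase (P t).derivative) q := by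
    intro q
    rw [← Polynomial.aeval_algHom_apply]
    simp only [φ, MvPolynomial.aeval_X, Matrix.cons_val_zero]
    rw [Polynomial.aeval_algebraMap_apply, Polynomial.aeval_X_left_apply]
  have hx0 : φ (MvPolynomial.X 0) = algebraMap (Polynomial ℂ) (QuadraticBase (P t).derivative) Polynomial.X := by simp [φ]
  have hy : φ (MvPolynomial.X 1) = (⟨0, 1⟩ : QuadraticBase (P t).derivative) := by simp [φ]
  have hC : ∀ c : ℂ, φ (MvPolynomial.C c) = algebraMap (Polynomial ℂ) (QuadraticBase (P t).derivative) (Polynomial.C c) := by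
    intro c
    have := hx (Polynomial.C c)
    rwa [Polynomial.aeval_C, MvPolynomial.algebraMap_eq] at this
  have e := congrArg φ hab
  rw [df_eq] at e
  simp only [map_add, map_mul, hx, hx0, hC, hy, map_pow, map_ofNat] at e
  have e1 := congrArg QuadraticAlgebra.re e
  have e2 := congrArg QuadraticAlgebra.im e
  have two : (2 : QuadraticBase (P t).derivative) = algebraMap (Polynomial ℂ) (QuadraticBase (P t).derivative) 2 := (map_ofNat _ 2).symm
  rw [two] at e1 e2
  simp only [QuadraticAlgebra.re_add, QuadraticAlgebra.im_add, QuadraticAlgebra.re_mul, sq,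
    QuadraticAlgebra.im_mul, QuadraticAlgebra.algebraMap_eq] at e1 e2
  obtain ⟨h1, h2⟩ := eq_zero_of_mul_system (R := (P t).derivative) (a := (φ b).re)
    (b := (φ b).im) (c := upoly u) (s := t (Fin.last m)) (e := u (Fin.last m))
    (derivative_P_ne_zero hm t)
    (by rw [natDegree_derivative_P hm]; exact upoly_natDegree_le u)
    (by linear_combination -e1) (by linear_combination -e2)
  exact ext_of_upoly (h1.trans (by simp [upoly])) h2

theorem df_single_last : df (Pi.single (Fin.last m) 1 : Params m) = MvPolynomial.X 1 := by
  simp [df, Fin.ext_iff, fun i : Fin m => i.2.ne]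

theorem df_single_castSucc (k : Fin m) :
    df (Pi.single k.castSucc 1 : Params m) = MvPolynomial.X 0 ^ (k : ℕ) := by
  rw [df, Finset.sum_eq_single k]
  · simp [Fin.ext_iff, k.2.ne']
  · intro i _ hi
    simp [Fin.ext_iff, Fin.val_inj, hi]
  · simp

/-! ### Normal forms with continuous coefficients -/

/-- A family of polynomials, depending on the parameter `t`, is congruent modulo the Jacobian ideal
of `f_t` to a combination of `1, x, …, x^(m-1), y` whose coefficients are continuous in `t`. -/
def HasContReduction (g : Params m → MvPolynomial (Fin 2) ℂ) : Prop :=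
  ∃ u : Params m → Params m, Continuous u ∧ ∀ t, g t - df (u t) ∈ jacobianIdeal (f t)

namespace HasContReduction

theorem const_df (u : Params m) : HasContReduction fun _ : Params m => df u :=
  ⟨fun _ => u, continuous_const, fun t => by simp⟩

theorem add {g h : Params m → MvPolynomial (Fin 2) ℂ} (hg : HasContReduction g)
    (hh : HasContReduction h) : HasContReduction fun t => g t + h t := by
  obtain ⟨u, hu, hu'⟩ := hg
  obtain ⟨v, hv, hv'⟩ := hh
  refine ⟨fun t => u t + v t, hu.add hv, fun t => ?_⟩
  have : df (u t + v t) = df (u t) + df (v t) := (dfLin m).map_add _ _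
  rw [this, add_sub_add_comm]
  exact add_mem (hu' t) (hv' t)

theorem smul {c : Params m → ℂ} (hc : Continuous c) {g : Params m → MvPolynomial (Fin 2) ℂ}
    (hg : HasContReduction g) : HasContReduction fun t => MvPolynomial.C (c t) * g t := by
  obtain ⟨u, hu, hu'⟩ := hg
  refine ⟨fun t => c t • u t, hc.smul hu, fun t => ?_⟩
  have : df (c t • u t) = c t • df (u t) := (dfLin m).map_smul _ _
  rw [this, MvPolynomial.smul_eq_C_mul, ← mul_sub]
  exact Ideal.mul_mem_left _ _ (hu' t)

theorem sum {ι : Type*} (s : Finset ι) {g : ι → Params m → MvPolynomial (Fin 2) ℂ}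
    (hg : ∀ i ∈ s, HasContReduction (g i)) : HasContReduction fun t => ∑ i ∈ s, g i t := by
  classical
  induction s using Finset.induction_on with
  | empty => simpa [df] using const_df (0 : Params m)
  | insert i s hi ih =>
    simp only [Finset.sum_insert hi]
    exact (hg i (Finset.mem_insert_self _ _)).add
      (ih fun j hj => hg j (Finset.mem_insert_of_mem hj))

theorem congr {g h : Params m → MvPolynomial (Fin 2) ℂ} (hg : HasContReduction g)
    (hgh : ∀ t, h t - g t ∈ jacobianIdeal (f t)) : HasContReduction h := by
  obtain ⟨u, hu, hu'⟩ := hg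
  refine ⟨u, hu, fun t => ?_⟩
  have := add_mem (hgh t) (hu' t)
  rwa [sub_add_sub_cancel] at this

theorem X_one : HasContReduction fun _ : Params m => (MvPolynomial.X 1 : MvPolynomial (Fin 2) ℂ) := by
  simpa only [df_single_last] using const_df (Pi.single (Fin.last m) 1 : Params m)

theorem X_zero_pow_of_lt {k : ℕ} (hk : k < m) :
    HasContReduction fun _ : Params m => (MvPolynomial.X 0 ^ k : MvPolynomial (Fin 2) ℂ) := by
  simpa only [df_single_castSucc] using const_df (Pi.single (Fin.castSucc ⟨k, hk⟩) 1 : Params m)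

theorem continuous_coord (i : Fin (m + 1)) : Continuous fun t : Params m => t i :=
  continuous_apply i

/-- In x ∂_x f - (y/2) ∂_y f the terms x y² cancel and x P' - t_n y/2 remains, whose leading term is
m x^m. -/
theorem X_zero_pow_self (hm : 1 ≤ m) :
    HasContReduction fun _ : Params m => (MvPolynomial.X 0 ^ m : MvPolynomial (Fin 2) ℂ) := by
  have h1 : HasContReduction fun t : Params m => MvPolynomial.C ((m : ℂ)⁻¹) *
      (MvPolynomial.C (t (Fin.last m) / 2) * MvPolynomial.X 1 +
        ∑ i : Fin m, MvPolynomial.C (-(t i.castSucc * i)) * MvPolynomial.X 0 ^ (i : ℕ)) :=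
    smul continuous_const ((smul ((continuous_coord _).div_const 2) X_one).add
      (sum _ fun i _ => smul (((continuous_coord _).mul continuous_const).neg)
        (X_zero_pow_of_lt i.2)))
  refine h1.congr fun t => mem_jacobianIdeal_f.2 ⟨MvPolynomial.C ((m : ℂ)⁻¹) * MvPolynomial.X 0,
    -(MvPolynomial.C ((m : ℂ)⁻¹) * MvPolynomial.C (1 / 2) * MvPolynomial.X 1), ?_⟩
  have hC : (MvPolynomial.C ((m : ℂ)⁻¹) * MvPolynomial.C (m : ℂ) : MvPolynomial (Fin 2) ℂ) = 1 := by
    rw [← map_mul, inv_mul_cancel₀ (by exact_mod_cast (by omega)), map_one]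
  have h2 : (MvPolynomial.C (1 / 2) * 2 : MvPolynomial (Fin 2) ℂ) = 1 := by
    rw [← map_ofNat MvPolynomial.C 2, ← map_mul]; norm_num
  have h3 : (MvPolynomial.C (t (Fin.last m) / 2) : MvPolynomial (Fin 2) ℂ) =
      MvPolynomial.C (1 / 2) * MvPolynomial.C (t (Fin.last m)) := by
    rw [← map_mul]; congr 1; ring
  have h4 : MvPolynomial.X 0 * Polynomial.aeval (MvPolynomial.X 0 : MvPolynomial (Fin 2) ℂ)
      (P t).derivative = MvPolynomial.C (m : ℂ) * MvPolynomial.X 0 ^ m -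
        ∑ i : Fin m, MvPolynomial.C (-(t i.castSucc * i)) * MvPolynomial.X 0 ^ (i : ℕ) := by
    rw [derivative_P]
    simp only [map_add, map_mul, map_sum, Polynomial.aeval_C, Polynomial.aeval_X, map_pow,
      MvPolynomial.algebraMap_eq, map_neg, neg_mul, Finset.sum_neg_distrib, sub_neg_eq_add, mul_add,
      Finset.mul_sum]
    congr 1
    · rw [mul_left_comm, ← pow_succ', Nat.sub_add_cancel hm]
    · refine Finset.sum_congr rfl fun i _ => ?_
      rcases Nat.eq_zero_or_pos (i : ℕ) with h | h
      · simp [h]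
      · rw [mul_left_comm, ← pow_succ', Nat.sub_add_cancel h]
  rw [h3]
  linear_combination MvPolynomial.C ((m : ℂ)⁻¹) * h4 + MvPolynomial.X 0 ^ m * hC -
    MvPolynomial.C ((m : ℂ)⁻¹) * MvPolynomial.X 0 * MvPolynomial.X 1 ^ 2 * h2

theorem X_zero_mul_X_one (hm : 1 ≤ m) : HasContReduction fun _ : Params m =>
    (MvPolynomial.X 0 * MvPolynomial.X 1 : MvPolynomial (Fin 2) ℂ) := by
  have h1 : HasContReduction fun t : Params m => MvPolynomial.C (-(t (Fin.last m)) / 2) *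
      (MvPolynomial.X 0 ^ 0 : MvPolynomial (Fin 2) ℂ) :=
    smul ((continuous_coord _).neg.div_const 2) (X_zero_pow_of_lt hm)
  refine h1.congr fun t => mem_jacobianIdeal_f.2 ⟨0, MvPolynomial.C (1 / 2), ?_⟩
  have h2 : (MvPolynomial.C (1 / 2) * 2 : MvPolynomial (Fin 2) ℂ) = 1 := by
    rw [← map_ofNat MvPolynomial.C 2, ← map_mul]; norm_num
  have h3 : (MvPolynomial.C (-(t (Fin.last m)) / 2) : MvPolynomial (Fin 2) ℂ) =
      -(MvPolynomial.C (1 / 2) * MvPolynomial.C (t (Fin.last m))) := by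
    rw [← map_mul, ← map_neg]; congr 1; ring
  rw [h3]
  linear_combination MvPolynomial.X 0 * MvPolynomial.X 1 * h2

theorem X_one_mul_X_zero_pow {k : ℕ} (hk : k < m) : HasContReduction fun _ : Params m =>
    (MvPolynomial.X 1 * MvPolynomial.X 0 ^ k : MvPolynomial (Fin 2) ℂ) := by
  rcases k with _ | k
  · simpa using X_one
  have h1 : HasContReduction fun t : Params m => MvPolynomial.C (-(t (Fin.last m)) / 2) *
      (MvPolynomial.X 0 ^ k : MvPolynomial (Fin 2) ℂ) :=
    smul ((continuous_coord _).neg.div_const 2) (X_zero_pow_of_lt (by omega))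
  refine h1.congr fun t => mem_jacobianIdeal_f.2
    ⟨0, MvPolynomial.C (1 / 2) * MvPolynomial.X 0 ^ k, ?_⟩
  have h2 : (MvPolynomial.C (1 / 2) * 2 : MvPolynomial (Fin 2) ℂ) = 1 := by
    rw [← map_ofNat MvPolynomial.C 2, ← map_mul]; norm_num
  have h3 : (MvPolynomial.C (-(t (Fin.last m)) / 2) : MvPolynomial (Fin 2) ℂ) =
      -(MvPolynomial.C (1 / 2) * MvPolynomial.C (t (Fin.last m))) := by
    rw [← map_mul, ← map_neg]; congr 1; ring
  rw [h3]
  linear_combination MvPolynomial.X 0 ^ k * MvPolynomial.X 0 * MvPolynomial.X 1 * h2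

theorem X_one_mul_X_one (hm : 1 ≤ m) : HasContReduction fun _ : Params m =>
    (MvPolynomial.X 1 * MvPolynomial.X 1 : MvPolynomial (Fin 2) ℂ) := by
  have h1 : HasContReduction fun t : Params m => MvPolynomial.C (-1) *
      (MvPolynomial.C (m : ℂ) * (MvPolynomial.X 0 ^ (m - 1) : MvPolynomial (Fin 2) ℂ) +
      ∑ i : Fin m, MvPolynomial.C (t i.castSucc * i) * MvPolynomial.X 0 ^ ((i : ℕ) - 1)) :=
    smul continuous_const ((smul continuous_const (X_zero_pow_of_lt (by omega))).add
      (sum _ fun i _ => smul ((continuous_coord _).mul continuous_const)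
        (X_zero_pow_of_lt (by omega))))
  refine h1.congr fun t => mem_jacobianIdeal_f.2 ⟨1, 0, ?_⟩
  rw [derivative_P]
  simp only [map_add, map_mul, map_sum, Polynomial.aeval_C, Polynomial.aeval_X, map_pow,
    MvPolynomial.algebraMap_eq, map_neg, map_one]
  ring

/-- Together with the constants this gives all polynomials by induction. It suffices to reduce the
products of a variable with the basis monomials; the continuous coefficients are carried along
linearly. -/
theorem X_mul (hm : 1 ≤ m) {g : Params m → MvPolynomial (Fin 2) ℂ} (hg : HasContReduction g)
    (j : Fin 2) : HasContReduction fun t => MvPolynomial.X j * g t := by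
  have hx : ∀ k < m, HasContReduction fun _ : Params m =>
      (MvPolynomial.X j * MvPolynomial.X 0 ^ k : MvPolynomial (Fin 2) ℂ) := by
    intro k hk
    fin_cases j
    · rcases Nat.lt_or_ge (k + 1) m with h | h
      · simpa [pow_succ'] using X_zero_pow_of_lt h
      · obtain rfl : m = k + 1 := by omega
        simpa [pow_succ'] using X_zero_pow_self hm
    · exact X_one_mul_X_zero_pow hk
  have hy : HasContReduction fun _ : Params m =>
      (MvPolynomial.X j * MvPolynomial.X 1 : MvPolynomial (Fin 2) ℂ) := by
    fin_cases j
    · exact X_zero_mul_X_one hm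
    · exact X_one_mul_X_one hm
  obtain ⟨u, hu, hu'⟩ := hg
  have h1 : HasContReduction fun t : Params m =>
      (∑ i : Fin m, MvPolynomial.C (u t i.castSucc) *
        (MvPolynomial.X j * MvPolynomial.X 0 ^ (i : ℕ) : MvPolynomial (Fin 2) ℂ)) +
      MvPolynomial.C (u t (Fin.last m)) * (MvPolynomial.X j * MvPolynomial.X 1) :=
    (sum Finset.univ fun (i : Fin m) _ => smul (c := fun t => u t i.castSucc)
      ((continuous_apply i.castSucc).comp hu) (hx i i.2)).add
      (smul (c := fun t => u t (Fin.last m)) ((continuous_apply (Fin.last m)).comp hu) hy)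
  refine h1.congr fun t => ?_
  convert Ideal.mul_mem_left _ (MvPolynomial.X j) (hu' t) using 1
  rw [df, mul_sub, mul_add, Finset.mul_sum]
  congr 2
  · exact Finset.sum_congr rfl fun i _ => by ring
  · ring

theorem const (hm : 1 ≤ m) (g : MvPolynomial (Fin 2) ℂ) :
    HasContReduction fun _ : Params m => g := by
  induction g using MvPolynomial.induction_on with
  | C a => simpa using smul (c := fun _ : Params m => a) continuous_const (X_zero_pow_of_lt hm)
  | add p q hp hq => exact hp.add hq
  | mul_X p j hp => simpa only [mul_comm p] using hp.X_mul hm j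

theorem deformation (hm : 1 ≤ m) : HasContReduction (f : Params m → MvPolynomial (Fin 2) ℂ) := by
  have h1 : HasContReduction fun t : Params m =>
      (MvPolynomial.X 0 ^ m + MvPolynomial.X 0 * MvPolynomial.X 1 ^ 2 : MvPolynomial (Fin 2) ℂ) +
        ((∑ i : Fin m, MvPolynomial.C (t i.castSucc) * MvPolynomial.X 0 ^ (i : ℕ)) +
          MvPolynomial.C (t (Fin.last m)) * MvPolynomial.X 1) :=
    (const hm _).add ((sum _ fun i _ => smul (continuous_coord _) (X_zero_pow_of_lt i.2)).add
      (smul (continuous_coord _) X_one))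
  refine h1.congr fun t => ?_
  convert zero_mem (jacobianIdeal (f t)) using 1
  simp only [f, P, map_add, map_sum, map_mul, map_pow, Polynomial.aeval_X, Polynomial.aeval_C,
    MvPolynomial.algebraMap_eq]
  ring

end HasContReduction

/-! ### The Kodaira–Spencer isomorphism and the explicit structure -/

/-- The Kodaira–Spencer map to the Jacobi ring. -/
def kodairaSpencer (t : Params m) :
    Params m →ₗ[ℂ] MvPolynomial (Fin 2) ℂ ⧸ jacobianIdeal (f t) :=
  (Ideal.Quotient.mkₐ ℂ (jacobianIdeal (f t))).toLinearMap ∘ₗ dfLin m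

theorem kodairaSpencer_apply (t u : Params m) :
    kodairaSpencer t u = Ideal.Quotient.mk (jacobianIdeal (f t)) (df u) := rfl

theorem kodairaSpencer_bijective (hm : 1 ≤ m) (t : Params m) :
    Function.Bijective (kodairaSpencer t) := by
  constructor
  · rw [← LinearMap.ker_eq_bot, LinearMap.ker_eq_bot']
    intro u hu
    rw [kodairaSpencer_apply, Ideal.Quotient.eq_zero_iff_mem] at hu
    exact eq_zero_of_df_mem hm hu
  · intro q
    obtain ⟨g, rfl⟩ := Ideal.Quotient.mk_surjective q
    obtain ⟨u, -, hu⟩ := HasContReduction.const hm g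
    exact ⟨u t, (Ideal.Quotient.eq.2 (hu t)).symm⟩

/-- The tangent vector whose image under the Kodaira–Spencer map is the class of a polynomial. -/
def reduce (hm : 1 ≤ m) (t : Params m) : MvPolynomial (Fin 2) ℂ →ₗ[ℂ] Params m :=
  (LinearEquiv.ofBijective _ (kodairaSpencer_bijective hm t)).symm.toLinearMap ∘ₗ
    (Ideal.Quotient.mkₐ ℂ (jacobianIdeal (f t))).toLinearMap

theorem reduce_eq_iff (hm : 1 ≤ m) {t u : Params m} {g : MvPolynomial (Fin 2) ℂ} :
    reduce hm t g = u ↔ g - df u ∈ jacobianIdeal (f t) := by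
  rw [← Ideal.Quotient.eq]
  exact LinearEquiv.symm_apply_eq (LinearEquiv.ofBijective _ (kodairaSpencer_bijective hm t))

theorem sub_df_reduce_mem (hm : 1 ≤ m) (t : Params m) (g : MvPolynomial (Fin 2) ℂ) :
    g - df (reduce hm t g) ∈ jacobianIdeal (f t) := (reduce_eq_iff hm).1 rfl

theorem reduce_df (hm : 1 ≤ m) (t u : Params m) : reduce hm t (df u) = u :=
  (reduce_eq_iff hm).2 (by simp)

theorem reduce_congr (hm : 1 ≤ m) {t : Params m} {g h : MvPolynomial (Fin 2) ℂ}
    (hgh : g - h ∈ jacobianIdeal (f t)) : reduce hm t g = reduce hm t h := by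
  rw [reduce_eq_iff]
  simpa using add_mem hgh (sub_df_reduce_mem hm t h)

theorem reduce_df_reduce_mul (hm : 1 ≤ m) (t : Params m) (g h : MvPolynomial (Fin 2) ℂ) :
    reduce hm t (df (reduce hm t g) * h) = reduce hm t (g * h) := by
  refine (reduce_congr hm ?_).symm
  rw [← sub_mul]
  exact Ideal.mul_mem_right _ _ (sub_df_reduce_mem hm t g)

/-- Normal forms are unique, so the continuous one supplied by `hg` is the value of `reduce`. -/
theorem continuous_reduce (hm : 1 ≤ m) {g : Params m → MvPolynomial (Fin 2) ℂ}
    (hg : HasContReduction g) : Continuous fun t => reduce hm t (g t) := by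
  obtain ⟨u, hu, hu'⟩ := hg
  convert hu using 2 with t
  exact (reduce_eq_iff hm).2 (hu' t)

/-- The residue functional on the tangent space. -/
def residue (m : ℕ) : Params m →ₗ[ℂ] ℂ where
  toFun u := (upoly u).coeff (m - 1) / (2 * m)
  map_add' u v := by simp [upoly, add_mul, Finset.sum_add_distrib, add_div]
  map_smul' c u := by simp [upoly, mul_div_assoc, mul_assoc, ← Finset.mul_sum]

theorem residue_apply (u : Params m) : residue m u = (upoly u).coeff (m - 1) / (2 * m) := rfl

theorem continuous_residue : Continuous (residue m) :=
  LinearMap.continuous_of_finiteDimensional _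

/-- The bilinear map `(u, v) ↦ ∂_u f · ∂_v f`. -/
def dfMul (m : ℕ) : Params m →ₗ[ℂ] Params m →ₗ[ℂ] MvPolynomial (Fin 2) ℂ :=
  (LinearMap.mul ℂ (MvPolynomial (Fin 2) ℂ)).compl₁₂ (dfLin m) (dfLin m)

/-- Saito's structure on the tangent space at `t`. -/
def saito (hm : 1 ≤ m) (t : Params m) : FrobeniusData (Params m) where
  pairing := (dfMul m).compr₂ (residue m ∘ₗ reduce hm t)
  mul := (dfMul m).compr₂ (reduce hm t)
  unit := reduce hm t 1
  euler := reduce hm t (f t)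

theorem saito_pairing (hm : 1 ≤ m) (t u v : Params m) :
    (saito hm t).pairing u v = residue m (reduce hm t (df u * df v)) := rfl

theorem saito_mul (hm : 1 ≤ m) (t u v : Params m) :
    (saito hm t).mul u v = reduce hm t (df u * df v) := rfl

/-! ### Sums over nondegenerate critical points -/

open Polynomial in
theorem roots_nodup_of_simple {Q : ℂ[X]} (hQ0 : Q ≠ 0)
    (hQ : ∀ x, Q.eval x = 0 → Q.derivative.eval x ≠ 0) : Q.roots.Nodup := by
  classical
  rw [Multiset.nodup_iff_count_le_one]
  intro a
  rw [count_roots]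
  by_contra! h
  rw [one_lt_rootMultiplicity_iff_isRoot hQ0] at h
  exact hQ a h.1 h.2

open Polynomial in
/-- The Lagrange interpolation formula for the leading coefficient, as a sum of residues. -/
theorem sum_eval_div_derivative {Q N : ℂ[X]} (hQ : ∀ x, Q.eval x = 0 → Q.derivative.eval x ≠ 0)
    (hN : N.natDegree < Q.natDegree) :
    ∑ x ∈ Q.roots.toFinset, N.eval x / Q.derivative.eval x =
      N.coeff (Q.natDegree - 1) / Q.leadingCoeff := by
  have hQ0 : Q ≠ 0 := by rintro rfl; simp at hN
  have hnd := roots_nodup_of_simple hQ0 hQ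
  set s := Q.roots.toFinset with hs
  have hval : s.val = Q.roots := by rw [hs, Multiset.toFinset_val, Multiset.dedup_eq_self.2 hnd]
  have hcard : s.card = Q.natDegree := by
    rw [Finset.card_def, hval, (IsAlgClosed.splits Q).natDegree_eq_card_roots]
  have hprod : Q = C Q.leadingCoeff * Lagrange.nodal s id := by
    conv_lhs => rw [(IsAlgClosed.splits Q).eq_prod_roots]
    rw [Lagrange.nodal_eq, Finset.prod, hval]; rfl
  have hder : ∀ x ∈ s, Q.derivative.eval x = Q.leadingCoeff * ∏ y ∈ s.erase x, (x - y) := by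
    intro x hx
    conv_lhs => rw [hprod]
    rw [derivative_C_mul, eval_C_mul]
    have := Lagrange.eval_nodal_derivative_eval_node_eq (v := id) hx
    simp only [id] at this
    rw [this, Lagrange.eval_nodal]; rfl
  rw [← hcard, Lagrange.coeff_eq_sum (s := s) (v := id) Function.injective_id.injOn
    (by rw [hcard]; exact degree_lt_iff_coeff_zero _ _ |>.2 fun k hk =>
          coeff_eq_zero_of_natDegree_lt (hN.trans_le hk)), Finset.sum_div]
  refine Finset.sum_congr rfl fun x hx => ?_
  rw [hder x hx, div_div, mul_comm]; rfl

theorem eval_aeval_X (p : Fin 2 → ℂ) (i : Fin 2) (q : Polynomial ℂ) :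
    MvPolynomial.eval p (Polynomial.aeval (MvPolynomial.X i) q) = q.eval (p i) := by
  have h := Polynomial.aeval_algHom_apply (MvPolynomial.aeval p : MvPolynomial (Fin 2) ℂ →ₐ[ℂ] ℂ)
    (MvPolynomial.X i) q
  rw [MvPolynomial.aeval_X, ← Polynomial.coe_aeval_eq_eval] at *
  exact h.symm

theorem eval_df (p : Fin 2 → ℂ) (u : Params m) :
    MvPolynomial.eval p (df u) = (upoly u).eval (p 0) + u (Fin.last m) * p 1 := by
  simp [df_eq, eval_aeval_X]

theorem gradient_f_zero (t : Params m) (p : Fin 2 → ℂ) :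
    gradient (f t) p 0 = (P t).derivative.eval (p 0) + p 1 ^ 2 := by
  simp [gradient, pderiv_zero_f, eval_aeval_X]

theorem gradient_f_one (t : Params m) (p : Fin 2 → ℂ) :
    gradient (f t) p 1 = 2 * p 0 * p 1 + t (Fin.last m) := by
  simp [gradient, pderiv_one_f]

theorem gradient_f_eq_iff (t : Params m) (p w : Fin 2 → ℂ) :
    gradient (f t) p = w ↔ (P t).derivative.eval (p 0) + p 1 ^ 2 = w 0 ∧
      2 * p 0 * p 1 + t (Fin.last m) = w 1 := by
  rw [funext_iff, Fin.forall_fin_two, gradient_f_zero, gradient_f_one]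

theorem hessian_f (t : Params m) (p : Fin 2 → ℂ) :
    hessian (f t) p = 2 * p 0 * (P t).derivative.derivative.eval (p 0) - 4 * p 1 ^ 2 := by
  have h2 : ∀ i, MvPolynomial.pderiv i (2 : MvPolynomial (Fin 2) ℂ) = 0 := fun i => by
    rw [← map_ofNat MvPolynomial.C 2, MvPolynomial.pderiv_C]
  simp [hessian, Matrix.det_fin_two, pderiv_zero_f, pderiv_one_f, Derivation.map_aeval,
    MvPolynomial.pderiv_X, Derivation.leibniz, eval_aeval_X, h2]
  ring

theorem eval_eq_zero_of_mem {t : Params m} {g : MvPolynomial (Fin 2) ℂ}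
    (hg : g ∈ jacobianIdeal (f t)) {p : Fin 2 → ℂ} (hp : gradient (f t) p = 0) :
    MvPolynomial.eval p g = 0 := by
  obtain ⟨a, b, rfl⟩ := mem_jacobianIdeal_f.1 hg
  obtain ⟨h1, h2⟩ := (gradient_f_eq_iff t p 0).1 hp
  simp only [Pi.zero_apply] at h1 h2
  simp [eval_aeval_X, h1, h2]

/-- The polynomial `4 x² P'(x) + t_n²`, whose roots are the abscissae of the critical points
if `t_n ≠ 0`. -/
def critPoly (t : Params m) : Polynomial ℂ :=
  Polynomial.C 4 * (P t).derivative * Polynomial.X ^ 2 + Polynomial.C (t (Fin.last m) ^ 2)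

theorem critPoly_eval (t : Params m) (x : ℂ) :
    (critPoly t).eval x = 4 * (P t).derivative.eval x * x ^ 2 + t (Fin.last m) ^ 2 := by
  simp [critPoly]

theorem critPoly_coeff (hm : 1 ≤ m) (t : Params m) : (critPoly t).coeff (m + 1) = 4 * m := by
  have : m + 1 = (m - 1) + 2 := by omega
  rw [critPoly, Polynomial.coeff_add, Polynomial.coeff_C_succ, this, Polynomial.coeff_mul_X_pow,
    Polynomial.coeff_C_mul, coeff_derivative_P hm, add_zero]

theorem four_mul_ne_zero (hm : 1 ≤ m) : (4 * m : ℂ) ≠ 0 :=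
  mul_ne_zero (by norm_num) (by exact_mod_cast (by omega))

theorem critPoly_natDegree (hm : 1 ≤ m) (t : Params m) : (critPoly t).natDegree = m + 1 := by
  refine le_antisymm ?_ (Polynomial.le_natDegree_of_ne_zero
    (by rw [critPoly_coeff hm]; exact four_mul_ne_zero hm))
  refine (Polynomial.natDegree_add_le _ _).trans (max_le ?_ (by simp))
  rw [mul_assoc]
  refine (Polynomial.natDegree_C_mul_le _ _).trans (Polynomial.natDegree_mul_le.trans ?_)
  rw [natDegree_derivative_P hm, Polynomial.natDegree_X_pow]; omega

theorem critPoly_leadingCoeff (hm : 1 ≤ m) (t : Params m) :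
    (critPoly t).leadingCoeff = 4 * m := by
  rw [Polynomial.leadingCoeff, critPoly_natDegree hm, critPoly_coeff hm]

/-- `2 x ∂_u f` at the point `(x, -t_n / (2 x))`. -/
def numPoly (t u : Params m) : Polynomial ℂ :=
  Polynomial.C 2 * upoly u * Polynomial.X - Polynomial.C (t (Fin.last m) * u (Fin.last m))

theorem numPoly_natDegree_le (hm : 1 ≤ m) (t u : Params m) : (numPoly t u).natDegree ≤ m := by
  refine (Polynomial.natDegree_sub_le _ _).trans
    (max_le ?_ ((Polynomial.natDegree_C _).trans_le (Nat.zero_le _)))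
  rw [mul_assoc]
  refine (Polynomial.natDegree_C_mul_le _ _).trans (Polynomial.natDegree_mul_le.trans ?_)
  have := upoly_natDegree_le u
  rw [Polynomial.natDegree_X]; omega

theorem numPoly_coeff (hm : 1 ≤ m) (t u : Params m) :
    (numPoly t u).coeff m = 2 * (upoly u).coeff (m - 1) := by
  obtain ⟨k, rfl⟩ : ∃ k, m = k + 1 := ⟨m - 1, by omega⟩
  rw [numPoly, Polynomial.coeff_sub, Polynomial.coeff_mul_X, Polynomial.coeff_C_succ,
    Polynomial.coeff_C_mul, sub_zero, Nat.add_sub_cancel]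

/-- The critical points are (x, -s/(2x)) for the roots x of `critPoly`. There `numPoly` equals 2x
∂_u f and the derivative of `critPoly` equals 2x H, so the sum is a Lagrange sum. It equals the
ratio of the coefficients 2 · coeff (m-1) and 4m. -/
theorem finsum_df_eq_residue_of_ne (hm : 1 ≤ m) {t : Params m} (hs : t (Fin.last m) ≠ 0)
    (h0 : 0 ∈ regularValues (f t)) (u : Params m) :
    ∑ᶠ p ∈ {p | gradient (f t) p = 0}, MvPolynomial.eval p (df u) / hessian (f t) p =
      residue m u := by
  set s := t (Fin.last m) with hs'
  have hQ0 : critPoly t ≠ 0 := by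
    intro h; have := critPoly_natDegree hm t; rw [h] at this; simp at this
  have hx0 : ∀ x, (critPoly t).eval x = 0 → x ≠ 0 := by
    rintro x hx rfl
    rw [critPoly_eval] at hx
    simp at hx; exact hs hx
  have hgrad : ∀ x, (critPoly t).eval x = 0 → gradient (f t) ![x, -s / (2 * x)] = 0 := by
    intro x hx
    have := hx0 x hx
    rw [critPoly_eval] at hx
    rw [gradient_f_eq_iff]
    simp only [Matrix.cons_val_zero, Matrix.cons_val_one, Pi.zero_apply]
    constructor
    · field_simp; linear_combination hx
    · field_simp; ring
  have hder : ∀ x, (critPoly t).eval x = 0 →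
      (critPoly t).derivative.eval x = 2 * x * hessian (f t) ![x, -s / (2 * x)] := by
    intro x hx
    have h1 := hx0 x hx
    rw [critPoly_eval] at hx
    rw [hessian_f, critPoly, Polynomial.derivative_add, Polynomial.derivative_C]
    simp only [Matrix.cons_val_zero, Matrix.cons_val_one]
    simp
    field_simp
    linear_combination 4 * hx
  have hnum : ∀ x, x ≠ 0 → (numPoly t u).eval x =
      2 * x * MvPolynomial.eval ![x, -s / (2 * x)] (df u) := by
    intro x hx
    rw [eval_df]
    simp only [Matrix.cons_val_zero, Matrix.cons_val_one, numPoly]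
    simp
    field_simp
    ring
  have hbij : Set.BijOn (fun x : ℂ => ![x, -s / (2 * x)])
      (↑(critPoly t).roots.toFinset : Set ℂ) {p | gradient (f t) p = 0} := by
    refine ⟨?_, ?_, ?_⟩
    · intro x hx
      simp only [Finset.mem_coe, Multiset.mem_toFinset, Polynomial.mem_roots hQ0] at hx
      exact hgrad x hx
    · intro x _ y _ hxy
      exact congrFun hxy 0
    · intro p hp
      obtain ⟨h1, h2⟩ := (gradient_f_eq_iff t p 0).1 hp
      simp only [Pi.zero_apply] at h1 h2
      have hp0 : p 0 ≠ 0 := by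
        intro h; rw [h] at h2; simp at h2; exact hs h2
      refine ⟨p 0, ?_, ?_⟩
      · simp only [Finset.mem_coe, Multiset.mem_toFinset, Polynomial.mem_roots hQ0,
          Polynomial.IsRoot, critPoly_eval]
        -- Elimination of y: 4x²P' + s² = 4x² ∂_x f + (s - 2xy) ∂_y f.
        linear_combination 4 * p 0 ^ 2 * h1 + (s - 2 * p 0 * p 1) * h2
      · funext i
        fin_cases i
        · rfl
        · change -s / (2 * p 0) = p 1
          rw [div_eq_iff (mul_ne_zero two_ne_zero hp0)]
          linear_combination -h2
  rw [← finsum_mem_eq_of_bijOn (f := fun x => (numPoly t u).eval x / (critPoly t).derivative.eval x)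
    _ hbij, finsum_mem_coe_finset, sum_eval_div_derivative, critPoly_leadingCoeff hm,
    critPoly_natDegree hm, Nat.add_sub_cancel, numPoly_coeff hm, residue_apply]
  · have := four_mul_ne_zero hm
    have : (m : ℂ) ≠ 0 := by exact_mod_cast (by omega)
    field_simp; ring
  · intro x hx
    rw [hder x hx]
    exact mul_ne_zero (mul_ne_zero two_ne_zero (hx0 x hx)) (h0 _ (hgrad x hx))
  · rw [critPoly_natDegree hm]; exact Nat.lt_succ_of_le (numPoly_natDegree_le hm t u)
  · intro x hx
    simp only [Finset.mem_coe, Multiset.mem_toFinset, Polynomial.mem_roots hQ0] at hx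
    rw [hder x hx, hnum x (hx0 x hx), mul_div_mul_left _ _ (mul_ne_zero two_ne_zero (hx0 x hx))]

/-- Now the critical locus splits into (x, 0) with P'(x) = 0 and (0, ±y) with y² = -P'(0). The sum
is half the Lagrange sum for x P'(x), whose root 0 stands for the pair (0, ±y). -/
theorem finsum_df_eq_residue_of_eq (hm : 1 ≤ m) {t : Params m} (hs : t (Fin.last m) = 0)
    (h0 : 0 ∈ regularValues (f t)) (u : Params m) :
    ∑ᶠ p ∈ {p | gradient (f t) p = 0}, MvPolynomial.eval p (df u) / hessian (f t) p =
      residue m u := by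
  set R := (P t).derivative with hR
  have hRne : R ≠ 0 := derivative_P_ne_zero hm t
  have hgx : ∀ x, R.eval x = 0 → gradient (f t) ![x, 0] = 0 := by
    intro x hx
    rw [gradient_f_eq_iff]
    simp [hs, ← hR, hx]
  -- Otherwise the origin would be a critical point with vanishing Hessian.
  have hR0 : R.eval 0 ≠ 0 := by
    intro h
    refine h0 ![0, 0] (hgx 0 h) ?_
    simp [hessian_f]
  obtain ⟨y, hy⟩ := IsAlgClosed.exists_pow_nat_eq (-R.eval 0) (n := 2) (by norm_num)
  have hy0 : y ≠ 0 := by rintro rfl; simp at hy; exact hR0 hy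
  have hset : {p | gradient (f t) p = 0} =
      (fun x : ℂ => ![x, 0]) '' (↑R.roots.toFinset : Set ℂ) ∪ {![0, y], ![0, -y]} := by
    ext p
    simp only [Set.mem_ofPred_eq, Set.mem_union, Set.mem_image, Finset.mem_coe,
      Multiset.mem_toFinset, Polynomial.mem_roots hRne, Set.mem_insert_iff,
      Set.mem_singleton_iff]
    constructor
    · intro hp
      obtain ⟨h1, h2⟩ := (gradient_f_eq_iff t p 0).1 hp
      simp only [Pi.zero_apply, hs, ← hR, add_zero] at h1 h2
      rcases mul_eq_zero.1 h2 with h | h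
      · have h : p 0 = 0 := by simpa using h
        right
        rw [h] at h1
        rcases sq_eq_sq_iff_eq_or_eq_neg.1 (show p 1 ^ 2 = y ^ 2 by linear_combination h1 - hy)
          with h' | h'
        · left; funext i; fin_cases i
          · exact h
          · exact h'
        · right; funext i; fin_cases i
          · exact h
          · exact h'
      · left
        refine ⟨p 0, by simpa [h] using h1, ?_⟩
        funext i; fin_cases i
        · rfl
        · exact h.symm
    · rintro (⟨x, hx, rfl⟩ | rfl | rfl)
      · exact hgx x hx
      · rw [gradient_f_eq_iff]; simp [hs, ← hR, hy]
      · rw [gradient_f_eq_iff]; simp [hs, ← hR, hy]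
  have hdisj : Disjoint ((fun x : ℂ => ![x, 0]) '' (↑R.roots.toFinset : Set ℂ))
      {![0, y], ![0, -y]} := by
    rw [Set.disjoint_left]
    rintro _ ⟨x, _, rfl⟩ (h | h)
    · exact hy0 (congrFun h 1).symm
    · exact hy0 (neg_eq_zero.1 (congrFun h 1).symm)
  have hyne : (![0, y] : Fin 2 → ℂ) ≠ ![0, -y] := by
    intro h
    have : y = -y := congrFun h 1
    exact hy0 (self_eq_neg.1 this)
  have hderR : ∀ x, R.eval x = 0 → x * R.derivative.eval x ≠ 0 := by
    intro x hx h
    refine h0 _ (hgx x hx) ?_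
    rw [hessian_f]
    simp only [Matrix.cons_val_zero, Matrix.cons_val_one, ← hR]
    linear_combination 2 * h
  have hderQ : ∀ x, (R * Polynomial.X).derivative.eval x = R.eval x + x * R.derivative.eval x := by
    intro x; simp; ring
  have hroots : (R * Polynomial.X).roots.toFinset = insert 0 R.roots.toFinset := by
    rw [Polynomial.roots_mul (mul_ne_zero hRne Polynomial.X_ne_zero), Polynomial.roots_X]
    ext; simp
  have hnat : (R * Polynomial.X).natDegree = m := by
    rw [Polynomial.natDegree_mul_X hRne, natDegree_derivative_P hm]; omega
  have hlead : (R * Polynomial.X).leadingCoeff = (m : ℂ) := by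
    rw [Polynomial.leadingCoeff_mul_X, Polynomial.leadingCoeff, natDegree_derivative_P hm,
      coeff_derivative_P hm]
  have hsum := sum_eval_div_derivative (Q := R * Polynomial.X) (N := upoly u)
    (by
      intro x hx
      rw [hderQ]
      rw [Polynomial.eval_mul, Polynomial.eval_X, mul_eq_zero] at hx
      rcases hx with hx | rfl
      · rw [hx, zero_add]; exact hderR x hx
      · simpa using hR0)
    (by rw [hnat]; have := upoly_natDegree_le u; omega)
  rw [hroots, Finset.sum_insert (by simp [hRne, hR0]), hnat, hlead, hderQ, zero_mul,
    add_zero] at hsum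
  have hsum' : ∑ x ∈ R.roots.toFinset, (upoly u).eval x / (R * Polynomial.X).derivative.eval x =
      2 * ∑ x ∈ R.roots.toFinset,
        MvPolynomial.eval ![x, 0] (df u) / hessian (f t) ![x, 0] := by
    rw [Finset.mul_sum]
    refine Finset.sum_congr rfl fun x hx => ?_
    have hx : R.eval x = 0 := by simpa [hRne] using hx
    have h1 := hderR x hx
    rw [hderQ, hx, zero_add, eval_df, hessian_f]
    simp only [Matrix.cons_val_zero, Matrix.cons_val_one, ← hR]
    have h3 : 2 * x * R.derivative.eval x - 4 * (0 : ℂ) ^ 2 = 2 * (x * R.derivative.eval x) := by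
      ring
    rw [h3, mul_zero, add_zero]
    field_simp
  rw [hset, finsum_mem_union hdisj ((Finset.finite_toSet _).image _) (by simp),
    finsum_mem_image (fun x _ x' _ h => congrFun h 0), finsum_mem_coe_finset,
    finsum_mem_pair hyne, residue_apply]
  simp only [eval_df, hessian_f] at hsum' ⊢
  simp only [Matrix.cons_val_zero, Matrix.cons_val_one, mul_zero, add_zero, zero_mul, zero_sub] at hsum' ⊢
  have hm0 : (m : ℂ) ≠ 0 := by exact_mod_cast (by omega)
  have e1 : -(4 * y ^ 2) = 4 * R.eval 0 := by linear_combination -4 * hy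
  have e2 : -(4 * (-y) ^ 2) = 4 * R.eval 0 := by linear_combination -4 * hy
  rw [hsum'] at hsum
  rw [e1, e2]
  -- At (0, ±y) the Hessian is -4y² = 4 P'(0). The contributions of y cancel, and the pair together
  -- gives half the Lagrange term at 0.
  have e3 : ((upoly u).eval 0 + u (Fin.last m) * y) / (4 * R.eval 0) +
      ((upoly u).eval 0 + u (Fin.last m) * -y) / (4 * R.eval 0) =
      (upoly u).eval 0 / R.eval 0 / 2 := by field_simp; ring
  have e4 : (upoly u).coeff (m - 1) / (2 * m) = (upoly u).coeff (m - 1) / m / 2 := by field_simp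
  rw [e3, e4, ← hsum]
  ring

theorem finsum_eq_residue (hm : 1 ≤ m) {t u : Params m} (h0 : 0 ∈ regularValues (f t))
    {g : MvPolynomial (Fin 2) ℂ} (hg : g - df u ∈ jacobianIdeal (f t)) :
    ∑ᶠ p ∈ {p | gradient (f t) p = 0}, MvPolynomial.eval p g / hessian (f t) p =
      residue m u := by
  have : ∑ᶠ p ∈ {p | gradient (f t) p = 0}, MvPolynomial.eval p g / hessian (f t) p =
      ∑ᶠ p ∈ {p | gradient (f t) p = 0}, MvPolynomial.eval p (df u) / hessian (f t) p := by
    refine finsum_mem_congr rfl fun p hp => ?_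
    have := eval_eq_zero_of_mem hg hp
    rw [map_sub, sub_eq_zero] at this
    rw [this]
  rw [this]
  rcases eq_or_ne (t (Fin.last m)) 0 with h | h
  · exact finsum_df_eq_residue_of_eq hm h h0 u
  · exact finsum_df_eq_residue_of_ne hm h h0 u

/-! ### Regular fibres of the gradient and the Grothendieck residue -/

/-- The parameter whose deformation is `f_t - w_0 x - w_1 y`. -/
def shift (hm : 2 ≤ m) (t : Params m) (w : Fin 2 → ℂ) : Params m :=
  t + (1 : ℂ) • -(w 0 • Pi.single (Fin.castSucc ⟨1, hm⟩) 1 + w 1 • Pi.single (Fin.last m) 1)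

theorem f_shift (hm : 2 ≤ m) (t : Params m) (w : Fin 2 → ℂ) : f (shift hm t w) =
    f t - (MvPolynomial.C (w 0) * MvPolynomial.X 0 + MvPolynomial.C (w 1) * MvPolynomial.X 1) := by
  rw [shift, f_add_smul, ← dfLin_apply]
  simp only [map_neg, map_add, map_smul, dfLin_apply, df_single_last, df_single_castSucc,
    MvPolynomial.smul_eq_C_mul, map_one]
  ring

theorem pderiv_f_shift (hm : 2 ≤ m) (t : Params m) (w : Fin 2 → ℂ) (i : Fin 2) :
    MvPolynomial.pderiv i (f (shift hm t w)) =
      MvPolynomial.pderiv i (f t) - MvPolynomial.C (w i) := by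
  rw [f_shift]
  fin_cases i <;> simp [MvPolynomial.pderiv_X, Derivation.leibniz]

theorem gradient_f_shift (hm : 2 ≤ m) (t : Params m) (w p : Fin 2 → ℂ) :
    gradient (f (shift hm t w)) p = 0 ↔ gradient (f t) p = w := by
  have : gradient (f (shift hm t w)) p = gradient (f t) p - w := by
    funext i; simp [gradient, pderiv_f_shift]
  rw [this, sub_eq_zero]

theorem hessian_f_shift (hm : 2 ≤ m) (t : Params m) (w p : Fin 2 → ℂ) :
    hessian (f (shift hm t w)) p = hessian (f t) p := by
  simp [hessian, pderiv_f_shift]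

theorem continuous_shift (hm : 2 ≤ m) (t : Params m) : Continuous (shift hm t) := by
  unfold shift; fun_prop

theorem finsum_gradient_eq (hm : 2 ≤ m) (t : Params m) {w : Fin 2 → ℂ}
    (hw : w ∈ regularValues (f t)) (g : MvPolynomial (Fin 2) ℂ) :
    ∑ᶠ (p : Fin 2 → ℂ) (_ : gradient (f t) p = w), MvPolynomial.eval p g / hessian (f t) p =
      residue m (reduce (by omega) (shift hm t w) g) := by
  rw [← finsum_eq_residue (by omega : 1 ≤ m) (t := shift hm t w) _
    (sub_df_reduce_mem (by omega) (shift hm t w) g)]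
  · simp only [Set.mem_ofPred_eq, gradient_f_shift, hessian_f_shift]
  · intro p hp
    rw [hessian_f_shift]
    exact hw p ((gradient_f_shift hm t w p).1 hp)

/-- On regular values the sum agrees with w ↦ residue of the normal form of g at the shifted
parameter. That function is continuous on all of ℂ², so degenerate critical points need no separate
analysis. -/
theorem isGlobalResidue_f (hm : 2 ≤ m) (t : Params m) (g : MvPolynomial (Fin 2) ℂ) :
    IsGlobalResidue (f t) g (residue m (reduce (by omega) t g)) := by
  have hc : Continuous fun w => residue m (reduce (by omega) (shift hm t w) g) :=
    continuous_residue.comp ((continuous_reduce (by omega)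
      (HasContReduction.const (by omega) g)).comp (continuous_shift hm t))
  have h0 : shift hm t 0 = t := by simp [shift]
  have h1 := (hc.tendsto 0).mono_left (nhdsWithin_le_nhds (s := regularValues (f t)))
  rw [h0] at h1
  refine h1.congr' ?_
  filter_upwards [self_mem_nhdsWithin] with w hw
  exact (finsum_gradient_eq hm t hw g).symm

/-- The regular values of the gradient map accumulate at the origin. -/
theorem nhdsWithin_regularValues_neBot (t : Params m) :
    (𝓝[regularValues (f t)] (0 : Fin 2 → ℂ)).NeBot := by
  rw [← mem_closure_iff_nhdsWithin_neBot, Metric.mem_closure_iff]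
  intro ε hε
  obtain ⟨b, hb, hbε⟩ := (dense_compl_singleton (t (Fin.last m))).exists_dist_lt 0 hε
  set σ := t (Fin.last m) - b with hσ
  have hσ0 : σ ≠ 0 := sub_ne_zero.2 (Ne.symm hb)
  set R := (P t).derivative with hR
  -- On the fibre 2xy = -σ, hence x² H = 2x³ P'' - σ². Degenerate points therefore have abscissa
  -- among the roots of W, and W ≠ 0 because σ ≠ 0.
  set W : Polynomial ℂ :=
    2 * R.derivative * Polynomial.X ^ 3 - Polynomial.C (σ ^ 2) with hW
  have hW0 : W ≠ 0 := by
    intro h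
    have := congrArg (Polynomial.eval 0) h
    simp [hW] at this
    exact hσ0 this
  -- The first component of the gradient at a degenerate point is P' + σ²/(4x²), which takes
  -- finitely many values on the roots of W; a small a avoids them.
  obtain ⟨a, ha, haε⟩ := (((W.roots.toFinset.image
    fun x => R.eval x + σ ^ 2 / (4 * x ^ 2)).countable_toSet).dense_compl ℂ).exists_dist_lt 0 hε
  refine ⟨![a, b], ?_, ?_⟩
  · intro p hp hH
    obtain ⟨h1, h2⟩ := (gradient_f_eq_iff t p _).1 hp
    simp only [Matrix.cons_val_zero, Matrix.cons_val_one, ← hR] at h1 h2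
    rw [hessian_f, ← hR] at hH
    have h2' : 2 * p 0 * p 1 = -σ := by rw [hσ]; linear_combination h2
    have hp0 : p 0 ≠ 0 := by
      intro h; rw [h] at h2'; simp at h2'; exact hσ0 h2'
    refine ha ?_
    simp only [Finset.coe_image, Set.mem_image, Finset.mem_coe, Multiset.mem_toFinset,
      Polynomial.mem_roots hW0]
    refine ⟨p 0, ?_, ?_⟩
    · simp [hW, Polynomial.IsRoot]
      linear_combination p 0 ^ 2 * hH + (2 * p 0 * p 1 - σ) * h2'
    · rw [← h1]
      field_simp
      linear_combination -(2 * p 0 * p 1 - σ) * h2'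
  · rw [dist_pi_lt_iff hε, Fin.forall_fin_two]
    exact ⟨haε, hbε⟩

theorem isSaito_iff (hm : 2 ≤ m) (t : Params m) (D : FrobeniusData (Params m)) :
    IsSaito t D ↔ D = saito (by omega) t := by
  constructor
  · intro h
    have := nhdsWithin_regularValues_neBot t
    ext u v
    · exact tendsto_nhds_unique (h.pairing _ _) (isGlobalResidue_f hm t _)
    · exact congrFun ((reduce_eq_iff (by omega)).2 (h.mul _ _)).symm _
    · exact congrFun ((reduce_eq_iff (by omega)).2 h.unit).symm _
    · exact congrFun ((reduce_eq_iff (by omega)).2 h.euler).symm _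
  · rintro rfl
    exact ⟨fun u v => isGlobalResidue_f hm t _, fun u v => sub_df_reduce_mem (by omega) t _,
      sub_df_reduce_mem (by omega) t _, sub_df_reduce_mem (by omega) t _⟩

/-! ### Asymptotics at infinity and circle integrals -/

-- Off the origin N(x)/x^d is the reflected polynomial at 1/x, and its constant term is the
-- coefficient of x^d in N.
open Bornology in
theorem tendsto_eval_div_pow_cobounded {N : Polynomial ℂ} {d : ℕ} (hN : N.natDegree ≤ d) :
    Tendsto (fun x => N.eval x / x ^ d) (cobounded ℂ) (𝓝 (N.coeff d)) := by
  have h1 : Tendsto (fun x : ℂ => (N.reflect d).eval x⁻¹) (cobounded ℂ)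
      (𝓝 ((N.reflect d).eval 0)) :=
    ((N.reflect d).continuous.tendsto 0).comp tendsto_inv₀_cobounded
  rw [← Polynomial.coeff_zero_eq_eval_zero, Polynomial.coeff_reflect,
    Polynomial.revAt_le (Nat.zero_le _), Nat.sub_zero] at h1
  refine h1.congr' ?_
  filter_upwards [eventually_ne_cobounded (0 : ℂ)] with x hx
  let := invertibleOfNonzero hx
  have := Polynomial.eval₂_reflect_mul_pow (RingHom.id ℂ) x d N hN
  rw [invOf_eq_inv] at this
  rw [eq_div_iff (pow_ne_zero _ hx)]
  simpa [Polynomial.eval₂_id] using this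

open Bornology in
theorem tendsto_eval_div_eval_cobounded {N Q : Polynomial ℂ} (hQ : Q ≠ 0)
    (hN : N.natDegree ≤ Q.natDegree) :
    Tendsto (fun x => N.eval x / Q.eval x) (cobounded ℂ)
      (𝓝 (N.coeff Q.natDegree / Q.leadingCoeff)) := by
  refine ((tendsto_eval_div_pow_cobounded hN).div (tendsto_eval_div_pow_cobounded le_rfl)
    (Polynomial.leadingCoeff_ne_zero.2 hQ)).congr' ?_
  filter_upwards [eventually_ne_cobounded (0 : ℂ)] with x hx
  exact div_div_div_cancel_right₀ (pow_ne_zero _ hx) _ _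

open Bornology in
theorem eventually_eval_ne_zero_cobounded {Q : Polynomial ℂ} (hQ : Q ≠ 0) :
    ∀ᶠ x in cobounded ℂ, Q.eval x ≠ 0 := by
  filter_upwards [(tendsto_eval_div_pow_cobounded (le_refl Q.natDegree)).eventually_ne
    (Polynomial.leadingCoeff_ne_zero.2 hQ)] with x hx h
  exact hx (by rw [h, zero_div])

open Bornology in
theorem tendsto_sq_cobounded : Tendsto (fun z : ℂ => z ^ 2) (cobounded ℂ) (cobounded ℂ) := by
  rw [← tendsto_norm_atTop_iff_cobounded]
  simp only [norm_pow]
  exact (tendsto_pow_atTop two_ne_zero).comp tendsto_norm_cobounded_atTop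

open Bornology in
theorem eventually_sphere_of_cobounded {p : ℂ → Prop} (h : ∀ᶠ z in cobounded ℂ, p z) :
    ∀ᶠ R : ℝ in atTop, ∀ z ∈ Metric.sphere (0 : ℂ) R, p z := by
  obtain ⟨R₀, -, hR₀⟩ := hasBasis_cobounded_norm.eventually_iff.1 h
  filter_upwards [eventually_ge_atTop R₀] with R hR z hz
  exact hR₀ (by simpa using hR.trans_eq (mem_sphere_zero_iff_norm.1 hz).symm)

open Bornology in
/-- If `z F(z) → c` at infinity, then the normalized integrals over large circles tend to `c`. -/
theorem tendsto_circleIntegral_of_tendsto_cobounded {F : ℂ → ℂ} {c : ℂ}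
    (hF : ∀ᶠ z in cobounded ℂ, ContinuousAt F z)
    (hc : Tendsto (fun z => z * F z) (cobounded ℂ) (𝓝 c)) :
    Tendsto (fun R : ℝ => (2 * π * Complex.I)⁻¹ * ∮ z in C(0, R), F z) atTop (𝓝 c) := by
  rw [Metric.tendsto_nhds]
  intro ε hε
  have hc' := eventually_sphere_of_cobounded (Metric.tendsto_nhds.1 hc (ε / 2) (half_pos hε))
  filter_upwards [hc', eventually_sphere_of_cobounded hF, eventually_gt_atTop 0] with R h1 h2 hR
  -- Subtracting c/z, whose integral is exactly 2πi c, leaves an integrand of size at most (ε/2)/R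
  -- on the circle.
  have hsub : (∮ z in C(0, R), (F z - c * (z - 0)⁻¹)) =
      (∮ z in C(0, R), F z) - c * (2 * π * Complex.I) := by
    rw [circleIntegral.integral_sub, circleIntegral.integral_const_mul,
      circleIntegral.integral_sub_center_inv _ hR.ne']
    · exact ContinuousOn.circleIntegrable hR.le fun z hz => (h2 z hz).continuousWithinAt
    · refine ContinuousOn.circleIntegrable hR.le (continuousOn_const.mul
        ((continuousOn_id.sub continuousOn_const).inv₀ fun z hz => ?_))
      simpa using Metric.ne_of_mem_sphere hz hR.ne'
  have hle := circleIntegral.norm_two_pi_i_inv_smul_integral_le_of_norm_le_const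
    (f := fun z => F z - c * (z - 0)⁻¹) (c := 0) (R := R) (C := ε / 2 / R) hR.le (by
      intro z hz
      have hz0 : z ≠ 0 := Metric.ne_of_mem_sphere hz hR.ne'
      have := h1 z hz
      rw [dist_eq_norm] at this
      have e : F z - c * (z - 0)⁻¹ = (z * F z - c) / z := by
        rw [sub_zero]; field_simp
      rw [e, norm_div, mem_sphere_zero_iff_norm.1 hz]
      gcongr)
  rw [dist_eq_norm]
  have h2pi : (2 * π * Complex.I : ℂ) ≠ 0 := Complex.two_pi_I_ne_zero
  have e : (2 * π * Complex.I : ℂ)⁻¹ * (∮ z in C(0, R), F z) - c =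
      (2 * π * Complex.I : ℂ)⁻¹ • ∮ z in C(0, R), (F z - c * (z - 0)⁻¹) := by
    rw [hsub, smul_eq_mul]; field_simp
  rw [e]
  refine hle.trans_lt ?_
  rw [mul_div_cancel₀ _ hR.ne']
  exact half_lt_self hε

/-- Circle integrals of a function that is holomorphic on `ℂ ∖ {0}` do not depend on the radius. -/
theorem circleIntegral_eq_of_differentiableAt {F : ℂ → ℂ} (hF : ∀ z ≠ 0, DifferentiableAt ℂ F z)
    {r : ℝ} (hr : 0 < r) : (∮ z in C(0, r), F z) = ∮ z in C(0, 1), F z := by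
  have key : ∀ r R : ℝ, 0 < r → r ≤ R → (∮ z in C(0, R), F z) = ∮ z in C(0, r), F z := by
    intro r R hr hrR
    refine Complex.circleIntegral_eq_of_differentiable_on_annulus_off_countable hr hrR
      Set.countable_empty (fun z hz => (hF z ?_).continuousAt.continuousWithinAt)
      (fun z hz => hF z ?_)
    · rintro rfl; exact hz.2 (Metric.mem_ball_self hr)
    · rintro rfl; exact hz.1.2 (Metric.mem_closedBall_self hr.le)
  rcases le_total r 1 with h | h
  · exact (key r 1 hr h).symm
  · exact key 1 r one_pos h

/-! ### The superpotential as a restriction of the deformation -/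

theorem P_add_smul (t u : Params m) (r : ℂ) :
    P (t + r • u) = P t + Polynomial.C r * upoly u := by
  simp only [P_eq, upoly, Pi.add_apply, Pi.smul_apply, smul_eq_mul, map_add, map_mul, add_mul,
    Finset.sum_add_distrib, Finset.mul_sum, mul_assoc, add_assoc]

/-- The point with abscissa `z²` on the curve `∂f/∂y = 0`. -/
def curve (t : Params m) (z : ℂ) : Fin 2 → ℂ := ![z ^ 2, -t (Fin.last m) / (2 * z ^ 2)]

/-- Substituting y = -t_n/(2z²) in z² y² + t_n y gives -t_n²/(4z²). At z = 0 the identity survives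
because division by zero gives 0. -/
theorem lam_eq (t : Params m) (z : ℂ) : lam t z = MvPolynomial.eval (curve t z) (f t) := by
  simp only [lam, f, map_add, map_mul, map_pow, eval_aeval_X, MvPolynomial.eval_X,
    MvPolynomial.eval_C, curve, Matrix.cons_val_zero, Matrix.cons_val_one]
  rcases eq_or_ne z 0 with rfl | hz
  · simp
  · field_simp; ring

/-- The curve moves with t, but ∂_y f_t vanishes along it for z ≠ 0, so only the explicit dependence
of f_t on t contributes. -/
theorem dlam_eq (t u : Params m) (z : ℂ) :
    dlam t u z = MvPolynomial.eval (curve t z) (df u) := by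
  have h1 : HasDerivAt (fun r : ℂ => (P t).eval (z ^ 2) + r * (upoly u).eval (z ^ 2) -
      (t (Fin.last m) + r * u (Fin.last m)) ^ 2 / (4 * z ^ 2))
      (1 * (upoly u).eval (z ^ 2) - (2 : ℕ) * (t (Fin.last m) + 0 * u (Fin.last m)) ^ (2 - 1) *
        (1 * u (Fin.last m)) / (4 * z ^ 2)) 0 :=
    (((hasDerivAt_id (0 : ℂ)).mul_const _).const_add _).sub
      (((((hasDerivAt_id (0 : ℂ)).mul_const _).const_add _).pow 2).div_const _)
  have h2 : dlam t u z = 1 * (upoly u).eval (z ^ 2) - (2 : ℕ) *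
      (t (Fin.last m) + 0 * u (Fin.last m)) ^ (2 - 1) * (1 * u (Fin.last m)) / (4 * z ^ 2) := by
    rw [← h1.deriv, dlam]
    congr 1
    funext r
    simp [lam, P_add_smul]
  rw [h2, eval_df]
  simp only [curve, Matrix.cons_val_zero, Matrix.cons_val_one]
  push_cast
  ring

theorem deriv_lam (t : Params m) {z : ℂ} (hz : z ≠ 0) :
    deriv (lam t) z = (critPoly t).eval (z ^ 2) / (2 * z ^ 3) := by
  have h1 : HasDerivAt (fun z : ℂ => z ^ 2) ((2 : ℕ) * z ^ (2 - 1)) z := hasDerivAt_pow 2 z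
  have h2 := (((P t).hasDerivAt (z ^ 2)).comp z h1).sub
    ((hasDerivAt_const z (t (Fin.last m) ^ 2)).div (h1.const_mul 4)
      (mul_ne_zero (by norm_num) (pow_ne_zero 2 hz)))
  have h3 : deriv (lam t) z = _ := h2.deriv
  rw [h3, critPoly_eval]
  push_cast
  field_simp
  ring

theorem differentiableAt_eval_curve (t : Params m) (a : MvPolynomial (Fin 2) ℂ) {z : ℂ}
    (hz : z ≠ 0) : DifferentiableAt ℂ (fun z => MvPolynomial.eval (curve t z) a) z := by
  induction a using MvPolynomial.induction_on with
  | C c => simp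
  | add p q hp hq =>
    simp only [map_add]
    exact hp.add hq
  | mul_X p i hp =>
    simp only [map_mul, MvPolynomial.eval_X]
    refine hp.mul ?_
    fin_cases i
    · simp [curve]
    · have : 2 * z ^ 2 ≠ 0 := mul_ne_zero two_ne_zero (pow_ne_zero 2 hz)
      simp only [curve, Fin.mk_one, Matrix.cons_val_one]
      exact (differentiableAt_const _).div ((differentiableAt_pow 2).const_mul 2) this

/-- On the curve ∂_y f vanishes and ∂_x f = Q(z²)/(4z⁴), while λ' = Q(z²)/(2z³). Dividing by λ'
turns a ∂_x f into a/(2z), so the ideal contributes no pole away from 0. -/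
theorem eval_curve_div_deriv_lam {t u : Params m} {G a b : MvPolynomial (Fin 2) ℂ}
    (hG : a * (Polynomial.aeval (MvPolynomial.X 0) (P t).derivative + MvPolynomial.X 1 ^ 2) +
      b * (2 * MvPolynomial.X 0 * MvPolynomial.X 1 + MvPolynomial.C (t (Fin.last m))) = G - df u)
    {z : ℂ} (hz : z ≠ 0) (hQ : (critPoly t).eval (z ^ 2) ≠ 0) :
    MvPolynomial.eval (curve t z) G / deriv (lam t) z =
      z * (numPoly t u).eval (z ^ 2) / (critPoly t).eval (z ^ 2) +
        MvPolynomial.eval (curve t z) a / (2 * z) := by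
  have h := congrArg (MvPolynomial.eval (curve t z)) hG
  rw [map_sub, eval_df] at h
  simp only [map_add, map_mul, eval_aeval_X, map_pow, MvPolynomial.eval_X, MvPolynomial.eval_C,
    map_ofNat] at h
  have c0 : curve t z 0 = z ^ 2 := rfl
  have c1 : curve t z 1 = -t (Fin.last m) / (2 * z ^ 2) := rfl
  have h1 : 2 * curve t z 0 * curve t z 1 + t (Fin.last m) = 0 := by
    rw [c0, c1]; field_simp; ring
  have h2 : (P t).derivative.eval (curve t z 0) + curve t z 1 ^ 2 =
      (critPoly t).eval (z ^ 2) / (4 * z ^ 4) := by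
    rw [c0, c1, critPoly_eval]; field_simp; ring
  have h3 : (upoly u).eval (curve t z 0) + u (Fin.last m) * curve t z 1 =
      (numPoly t u).eval (z ^ 2) / (2 * z ^ 2) := by
    rw [c0, c1, numPoly]; simp; field_simp; ring
  rw [h1, h2, h3, mul_zero, add_zero] at h
  rw [deriv_lam t hz, ← sub_add_cancel (MvPolynomial.eval (curve t z) G)
    ((numPoly t u).eval (z ^ 2) / (2 * z ^ 2)), ← h]
  field_simp
  ring

-- The term F₂ = a/(2z) has the same integral K over every circle, entering with opposite signs at 0
-- and ∞. The term F₁ is holomorphic near 0, as Q(0) = t_n² ≠ 0, and z F₁ tends to the residue of u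
-- at infinity.
open Bornology in
theorem resLam_eq (hm : 1 ≤ m) {t u : Params m} (hs : t (Fin.last m) ≠ 0)
    {G : MvPolynomial (Fin 2) ℂ} (hG : G - df u ∈ jacobianIdeal (f t)) :
    resLam t (fun z => MvPolynomial.eval (curve t z) G) = -residue m u := by
  obtain ⟨a, b, hab⟩ := mem_jacobianIdeal_f.1 hG
  set F : ℂ → ℂ := fun z => MvPolynomial.eval (curve t z) G / deriv (lam t) z with hF
  set F₁ : ℂ → ℂ := fun z => z * (numPoly t u).eval (z ^ 2) / (critPoly t).eval (z ^ 2) with hF₁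
  set F₂ : ℂ → ℂ := fun z => MvPolynomial.eval (curve t z) a / (2 * z) with hF₂
  have hQ0 : critPoly t ≠ 0 := by
    intro h; have := critPoly_natDegree hm t; rw [h] at this; simp at this
  have hd₁ : ∀ z, (critPoly t).eval (z ^ 2) ≠ 0 → DifferentiableAt ℂ F₁ z := fun z hz =>
    (differentiableAt_id.mul ((numPoly t u).differentiable.differentiableAt.comp z
      (differentiableAt_pow 2))).div ((critPoly t).differentiable.differentiableAt.comp z
      (differentiableAt_pow 2)) hz
  have hd₂ : ∀ z, z ≠ 0 → DifferentiableAt ℂ F₂ z := fun z hz =>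
    (differentiableAt_eval_curve t a hz).div (differentiableAt_id.const_mul 2)
      (mul_ne_zero two_ne_zero hz)
  have hsplit : ∀ r : ℝ, 0 < r → (∀ z ∈ Metric.sphere (0 : ℂ) r, (critPoly t).eval (z ^ 2) ≠ 0) →
      (∮ z in C(0, r), F z) = (∮ z in C(0, r), F₁ z) + ∮ z in C(0, 1), F₂ z := by
    intro r hr hQ
    have hz0 : ∀ z ∈ Metric.sphere (0 : ℂ) r, z ≠ 0 := fun z hz => Metric.ne_of_mem_sphere hz hr.ne'
    rw [← circleIntegral_eq_of_differentiableAt hd₂ hr, ← circleIntegral.integral_add]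
    · exact circleIntegral.integral_congr hr.le fun z hz =>
        eval_curve_div_deriv_lam hab (hz0 z hz) (hQ z hz)
    · exact ContinuousOn.circleIntegrable hr.le fun z hz =>
        (hd₁ z (hQ z hz)).continuousAt.continuousWithinAt
    · exact ContinuousOn.circleIntegrable hr.le fun z hz =>
        (hd₂ z (hz0 z hz)).continuousAt.continuousWithinAt
  set K := (2 * π * Complex.I : ℂ)⁻¹ * ∮ z in C(0, 1), F₂ z with hK
  have hzero : Tendsto (fun r : ℝ => (2 * π * Complex.I : ℂ)⁻¹ * ∮ z in C(0, r), F z)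
      (𝓝[>] 0) (𝓝 K) := by
    have hev : ∀ᶠ z in 𝓝 (0 : ℂ), (critPoly t).eval (z ^ 2) ≠ 0 := by
      have hc : ContinuousAt (fun z : ℂ => (critPoly t).eval (z ^ 2)) 0 :=
        ((critPoly t).continuous.comp (continuous_pow 2)).continuousAt
      refine hc.eventually_ne ?_
      rw [critPoly_eval]; simpa using hs
    obtain ⟨δ, hδ, hball⟩ := Metric.eventually_nhds_iff_ball.1 hev
    refine tendsto_const_nhds.congr' ?_
    filter_upwards [Ioo_mem_nhdsGT hδ] with r hr
    have hcl : ∀ z ∈ Metric.closedBall (0 : ℂ) r, (critPoly t).eval (z ^ 2) ≠ 0 := fun z hz =>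
      hball z (Metric.closedBall_subset_ball hr.2 hz)
    rw [hsplit r hr.1 fun z hz => hcl z (Metric.sphere_subset_closedBall hz),
      Complex.circleIntegral_eq_zero_of_differentiable_on_off_countable hr.1.le Set.countable_empty
        (fun z hz => (hd₁ z (hcl z hz)).continuousAt.continuousWithinAt)
        (fun z hz => hd₁ z (hcl z (Metric.ball_subset_closedBall hz.1))), zero_add]
  have hQinf : ∀ᶠ z in cobounded ℂ, (critPoly t).eval (z ^ 2) ≠ 0 :=
    tendsto_sq_cobounded.eventually (eventually_eval_ne_zero_cobounded hQ0)
  have hlim : Tendsto (fun z => z * F₁ z) (cobounded ℂ) (𝓝 (residue m u)) := by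
    have h1 := (tendsto_eval_div_eval_cobounded (N := numPoly t u * Polynomial.X) hQ0 (by
      rw [critPoly_natDegree hm]
      refine Polynomial.natDegree_mul_le.trans ?_
      have := numPoly_natDegree_le hm t u
      rw [Polynomial.natDegree_X]; omega)).comp tendsto_sq_cobounded
    rw [critPoly_natDegree hm, Polynomial.coeff_mul_X, numPoly_coeff hm,
      critPoly_leadingCoeff hm] at h1
    have e : 2 * (upoly u).coeff (m - 1) / (4 * m) = residue m u := by
      have : (m : ℂ) ≠ 0 := by exact_mod_cast (by omega)
      rw [residue_apply]; field_simp; ring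
    rw [e] at h1
    refine h1.congr fun z => ?_
    simp only [Function.comp_apply, hF₁, Polynomial.eval_mul, Polynomial.eval_X]
    ring
  have hinf : Tendsto (fun R : ℝ => -((2 * π * Complex.I : ℂ)⁻¹ * ∮ z in C(0, R), F z))
      atTop (𝓝 (-(residue m u + K))) := by
    have h1 := ((tendsto_circleIntegral_of_tendsto_cobounded
      (hQinf.mono fun z hz => (hd₁ z hz).continuousAt) hlim).add_const K).neg
    refine h1.congr' ?_
    filter_upwards [eventually_sphere_of_cobounded hQinf, eventually_gt_atTop 0] with R hR hR0
    rw [hsplit R hR0 hR, mul_add]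
  have e1 : resInfty F = -(residue m u + K) := hinf.limUnder_eq
  have e2 : resZero F = K := hzero.limUnder_eq
  change resInfty F + resZero F = _
  rw [e1, e2]; ring

/-! ### Nondegeneracy of the residue pairing -/

theorem residue_reduce_aeval (hm : 1 ≤ m) (t : Params m) {q : Polynomial ℂ} (hq : q.natDegree < m) :
    residue m (reduce hm t (Polynomial.aeval (MvPolynomial.X 0) q)) =
      q.coeff (m - 1) / (2 * m) := by
  let u : Params m := Fin.snoc (fun i : Fin m => q.coeff i) 0
  have hu : upoly u = q := by
    rw [upoly, q.as_sum_range_C_mul_X_pow' hq, Finset.sum_range]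
    simp [u]
  have hdf : df u = Polynomial.aeval (MvPolynomial.X 0) q := by
    rw [df_eq, hu]; simp [u]
  rw [← hdf, reduce_df, residue_apply, hu]

/-- For k ≥ 1, x^k y ≡ -(t_n/2) x^(k-1), of degree below m - 1; for k = 0 the normal form y has no
x^(m-1) term. -/
theorem residue_reduce_X_zero_pow_mul_X_one (hm : 1 ≤ m) (t : Params m) {k : ℕ} (hk : k < m) :
    residue m (reduce hm t (MvPolynomial.X 0 ^ k * MvPolynomial.X 1)) = 0 := by
  rcases k with _ | k
  · rw [pow_zero, one_mul, ← df_single_last (m := m), reduce_df, residue_apply]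
    have : (upoly (Pi.single (Fin.last m) 1 : Params m)) = 0 := by
      simp [upoly, Fin.ext_iff, fun i : Fin m => i.2.ne]
    rw [this]; simp
  · have h : MvPolynomial.X 0 ^ (k + 1) * MvPolynomial.X 1 -
        Polynomial.aeval (MvPolynomial.X 0 : MvPolynomial (Fin 2) ℂ)
          (Polynomial.C (-(t (Fin.last m)) / 2) * Polynomial.X ^ k) ∈ jacobianIdeal (f t) := by
      refine mem_jacobianIdeal_f.2 ⟨0, MvPolynomial.C (1 / 2) * MvPolynomial.X 0 ^ k, ?_⟩
      have h2 : (MvPolynomial.C (1 / 2) * 2 : MvPolynomial (Fin 2) ℂ) = 1 := by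
        rw [← map_ofNat MvPolynomial.C 2, ← map_mul]; norm_num
      have h3 : (MvPolynomial.C (-(t (Fin.last m)) / 2) : MvPolynomial (Fin 2) ℂ) =
          -(MvPolynomial.C (1 / 2) * MvPolynomial.C (t (Fin.last m))) := by
        rw [← map_mul, ← map_neg]; congr 1; ring
      rw [map_mul, Polynomial.aeval_C, MvPolynomial.algebraMap_eq, h3, map_pow, Polynomial.aeval_X]
      linear_combination MvPolynomial.X 0 ^ k * MvPolynomial.X 0 * MvPolynomial.X 1 * h2
    have hd := Polynomial.natDegree_C_mul_X_pow_le (-(t (Fin.last m)) / 2) k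
    rw [reduce_congr hm h, residue_reduce_aeval hm t (by omega),
      Polynomial.coeff_eq_zero_of_natDegree_lt (by omega), zero_div]

theorem residue_reduce_X_one_sq (hm : 1 ≤ m) (t : Params m) :
    residue m (reduce hm t (MvPolynomial.X 1 * MvPolynomial.X 1)) = -(1 / 2) := by
  have h : MvPolynomial.X 1 * MvPolynomial.X 1 -
      Polynomial.aeval (MvPolynomial.X 0 : MvPolynomial (Fin 2) ℂ) (-(P t).derivative) ∈
        jacobianIdeal (f t) :=
    mem_jacobianIdeal_f.2 ⟨1, 0, by rw [map_neg]; ring⟩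
  rw [reduce_congr hm h, residue_reduce_aeval hm t, Polynomial.coeff_neg, coeff_derivative_P hm]
  · have : (m : ℂ) ≠ 0 := by exact_mod_cast (by omega)
    field_simp
  · rw [Polynomial.natDegree_neg, natDegree_derivative_P hm]; omega

/-- The residue pairing is nondegenerate. -/
theorem eq_zero_of_saito_pairing (hm : 1 ≤ m) (t : Params m) {u : Params m}
    (h : ∀ v, (saito hm t).pairing u v = 0) : u = 0 := by
  -- The vector of y is orthogonal to all x^i with i < m and has square -1/2, so pairing with it
  -- isolates the last coordinate.
  have hlast : u (Fin.last m) = 0 := by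
    have h1 := h (Pi.single (Fin.last m) 1)
    have e : df u * MvPolynomial.X 1 =
        (∑ i : Fin m, u i.castSucc • (MvPolynomial.X 0 ^ (i : ℕ) * MvPolynomial.X 1)) +
          u (Fin.last m) • (MvPolynomial.X 1 * MvPolynomial.X 1) := by
      simp only [df, MvPolynomial.smul_eq_C_mul, add_mul, Finset.sum_mul, mul_assoc]
    rw [saito_pairing, df_single_last, e, map_add, map_add, map_sum, map_sum, map_smul, map_smul,
      residue_reduce_X_one_sq, Finset.sum_eq_zero, zero_add, smul_eq_mul] at h1
    · simpa using h1
    · intro i _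
      rw [map_smul, map_smul, residue_reduce_X_zero_pow_mul_X_one hm t i.2, smul_zero]
  have hU : upoly u = 0 := by
    by_contra hU
    have hd := upoly_natDegree_le u
    set d := (upoly u).natDegree with hd'
    -- Multiplication by x^(m-1-d) moves the leading term x^d to x^(m-1), where the residue reads it
    -- off.
    have h1 := h (Pi.single (Fin.castSucc ⟨m - 1 - d, by omega⟩) 1)
    have e : df u * MvPolynomial.X 0 ^ (m - 1 - d) =
        Polynomial.aeval (MvPolynomial.X 0) (upoly u * Polynomial.X ^ (m - 1 - d)) := by
      rw [df_eq, hlast]; simp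
    have hk : m - 1 = d + (m - 1 - d) := by omega
    rw [saito_pairing, df_single_castSucc, e, residue_reduce_aeval] at h1
    · have hc : (upoly u * Polynomial.X ^ (m - 1 - d)).coeff (m - 1) = (upoly u).leadingCoeff := by
        have hc := Polynomial.coeff_mul_X_pow (upoly u) (m - 1 - d) d
        rwa [← hk] at hc
      rw [hc, div_eq_zero_iff] at h1
      rcases h1 with h1 | h1
      · exact hU (Polynomial.leadingCoeff_eq_zero.1 h1)
      · exact absurd h1 (mul_ne_zero two_ne_zero (by exact_mod_cast (by omega)))
    · rw [Polynomial.natDegree_mul_X_pow _ hU]; omega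
  exact ext_of_upoly (hU.trans (by simp [upoly])) hlast

theorem eq_of_saito_pairing (hm : 1 ≤ m) (t : Params m) {u v : Params m}
    (h : ∀ s, (saito hm t).pairing u s = (saito hm t).pairing v s) : u = v := by
  rw [← sub_eq_zero]
  refine eq_zero_of_saito_pairing hm t fun s => ?_
  rw [map_sub, LinearMap.sub_apply, h s, sub_self]

/-! ### Comparison of the two structures -/

theorem saito_mul_comm (hm : 1 ≤ m) (t u v : Params m) :
    (saito hm t).mul u v = (saito hm t).mul v u := by
  rw [saito_mul, saito_mul, mul_comm]

theorem saito_unit_mul (hm : 1 ≤ m) (t v : Params m) :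
    (saito hm t).mul (saito hm t).unit v = v := by
  change reduce hm t (df (reduce hm t 1) * df v) = v
  rw [reduce_df_reduce_mul, one_mul, reduce_df]

theorem resLam_pairing (hm : 1 ≤ m) {t : Params m} (hs : t (Fin.last m) ≠ 0) (u v : Params m) :
    resLam t (fun z => dlam t u z * dlam t v z) = -(saito hm t).pairing u v := by
  simp only [dlam_eq, ← map_mul]
  exact resLam_eq hm hs (sub_df_reduce_mem hm t _)

theorem resLam_mul (hm : 1 ≤ m) {t : Params m} (hs : t (Fin.last m) ≠ 0) (u v w : Params m) :
    resLam t (fun z => dlam t u z * dlam t v z * dlam t w z) =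
      -(saito hm t).pairing ((saito hm t).mul u v) w := by
  simp only [dlam_eq, ← map_mul]
  rw [resLam_eq hm hs (sub_df_reduce_mem hm t _), saito_pairing, saito_mul, reduce_df_reduce_mul]

theorem resLam_euler (hm : 1 ≤ m) {t : Params m} (hs : t (Fin.last m) ≠ 0) (w : Params m) :
    resLam t (fun z => lam t z * dlam t w z) =
      -(saito hm t).pairing (saito hm t).euler w := by
  simp only [dlam_eq, lam_eq, ← map_mul]
  rw [resLam_eq hm hs (sub_df_reduce_mem hm t _), saito_pairing]
  change _ = -residue m (reduce hm t (df (reduce hm t (f t)) * df w))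
  rw [reduce_df_reduce_mul]

/-- All three residue formulas are c times the corresponding Saito pairings, and c appears on both
sides of those defining product and Euler vector. Cancelling it and using nondegeneracy shows that
only the pairing depends on c. -/
theorem isLG_iff (hm : 1 ≤ m) {t : Params m} (hs : t (Fin.last m) ≠ 0) {c : ℂ} (hc : c ≠ 0)
    (D : FrobeniusData (Params m)) : IsLG (-c) t D ↔ D = (saito hm t).rescale c := by
  constructor
  · intro h
    have hp : ∀ u v, D.pairing u v = c * (saito hm t).pairing u v := fun u v => by
      rw [h.pairing, resLam_pairing hm hs, neg_mul_neg]
    have hmul : ∀ u v, D.mul u v = (saito hm t).mul u v := fun u v =>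
      eq_of_saito_pairing hm t fun s => mul_left_cancel₀ hc (by
        rw [← hp, h.mul, resLam_mul hm hs, neg_mul_neg])
    apply FrobeniusData.ext
    · exact LinearMap.ext₂ hp
    · exact LinearMap.ext₂ hmul
    · change D.unit = (saito hm t).unit
      -- A left unit applied to the Saito unit gives the Saito unit; by commutativity the same
      -- product is `D.unit`.
      have h1 := h.unit (saito hm t).unit
      rwa [hmul, saito_mul_comm, saito_unit_mul] at h1
    · exact eq_of_saito_pairing hm t fun s => mul_left_cancel₀ hc (by
        rw [← hp, h.euler, resLam_euler hm hs, neg_mul_neg]; rfl)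
  · rintro rfl
    refine ⟨fun u v => ?_, fun u v w => ?_, fun v => saito_unit_mul hm t v, fun w => ?_⟩
    · rw [resLam_pairing hm hs, neg_mul_neg]; rfl
    · rw [resLam_mul hm hs, neg_mul_neg]; rfl
    · rw [resLam_euler hm hs, neg_mul_neg]; rfl

theorem rescale_one (D : FrobeniusData (Params m)) : D.rescale 1 = D := by
  simp [FrobeniusData.rescale]

end DSing

end

theorem mainTheorem7 (m : ℕ) (hm : 2 ≤ m) :
    ∃ D : DSing.Params m → DSing.FrobeniusData (DSing.Params m),
      (∀ (t : DSing.Params m) (D' : DSing.FrobeniusData (DSing.Params m)),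
        DSing.IsSaito t D' ↔ D' = D t) ∧
      (∀ u v : DSing.Params m, Continuous fun t => (D t).pairing u v) ∧
      (∀ u v : DSing.Params m, Continuous fun t => (D t).mul u v) ∧
      (Continuous fun t => (D t).unit) ∧
      (Continuous fun t => (D t).euler) ∧
      ∀ t : DSing.Params m, t (Fin.last m) ≠ 0 →
        ∀ D' : DSing.FrobeniusData (DSing.Params m),
          (DSing.IsLG (-1) t D' ↔ D' = D t) ∧
          (DSing.IsLG (-2) t D' ↔ D' = (D t).rescale 2) := by
  have hm1 : 1 ≤ m := by omega
  refine ⟨DSing.saito hm1, DSing.isSaito_iff hm, fun u v => ?_, fun u v => ?_, ?_, ?_,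
    fun t ht D' => ⟨?_, DSing.isLG_iff hm1 ht two_ne_zero D'⟩⟩
  · exact DSing.continuous_residue.comp
      (DSing.continuous_reduce hm1 (DSing.HasContReduction.const hm1 _))
  · exact DSing.continuous_reduce hm1 (DSing.HasContReduction.const hm1 _)
  · exact DSing.continuous_reduce hm1 (DSing.HasContReduction.const hm1 _)
  · exact DSing.continuous_reduce hm1 (DSing.HasContReduction.deformation hm1)
  · rw [DSing.isLG_iff hm1 ht one_ne_zero, DSing.rescale_one]
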